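/- A set of points in the plane is in general position if no three of its points are collinear. Let $R$ (red points) and $B$ (blue points) be disjoint finite sets in $\mathbb{R}^2$ such that $R\cup B$ is in general position. A 4-gon on four distinct points is regarded as a closed subset of the plane: its boundary curve together with everything enclosed by the curve. A \emph{bowtie} is a self-intersecting 4-gon whose four vertices are in convex position. A \emph{pant} is a simple 4-gon whose four vertices are in non-convex position. A \emph{red structure} is a pant or a bowtie whose four vertices are red and which contains no further red point. The set $B$ \emph{blocks} $R$ if every red structure contains at least one point of $B$. The set $R$ \emph{requires} $b$ blockers if $|B|\ge b$ for every finite set $B$, disjoint from $R$ and with $R\cup B$ in general position, that blocks $R$. Then the following holds. 1. Every set $R$ of 6 points in general position requires 5 blockers. 2. Every set $R$ of 7 points in general position requires 6 blockers. 3. Every set $R$ of 5 points in general position whose convex hull has exactly 3 or exactly 5 vertices requires 4 blockers. -/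

import Mathlib

/-- The Euclidean plane. -/
abbrev Plane : Type := EuclideanSpace ℝ (Fin 2)

/-- A set of points is in general position if no three distinct points of it are collinear. -/
def GeneralPosition (P : Set Plane) : Prop :=
  ∀ a ∈ P, ∀ b ∈ P, ∀ c ∈ P, a ≠ b → a ≠ c → b ≠ c → ¬ Collinear ℝ {a, b, c}

/-- The closed polygonal curve `v 0, v 1, v 2, v 3, v 0` (indices are taken modulo 4). -/
def fourGonBoundary (v : Fin 4 → Plane) : Set Plane :=
  ⋃ i : Fin 4, segment ℝ (v i) (v (i + 1))

/-- The closed region of the 4-gon with vertices `v 0, v 1, v 2, v 3` in this cyclic order: the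
curve itself together with everything it encloses, that is, the points whose connected component
in the complement of the curve is bounded. -/
def fourGon (v : Fin 4 → Plane) : Set Plane :=
  {p | p ∈ fourGonBoundary v ∨
    Bornology.IsBounded (connectedComponentIn (fourGonBoundary v)ᶜ p)}

/-- The 4-gon is simple: consecutive sides meet only in their common vertex, and opposite sides
are disjoint. -/
def IsSimpleFourGon (v : Fin 4 → Plane) : Prop :=
  ∀ i : Fin 4,
    segment ℝ (v i) (v (i + 1)) ∩ segment ℝ (v (i + 1)) (v (i + 2)) = {v (i + 1)} ∧
    Disjoint (segment ℝ (v i) (v (i + 1))) (segment ℝ (v (i + 2)) (v (i + 3)))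

/-- A type of structures on four points, given by the relation
"the set `Q` is a structure of this type induced by the four points of `V`". -/
abbrev StructureType : Type := Set Plane → Set Plane → Prop

/-- A bowtie: a self-intersecting 4-gon whose four vertices are in convex position. -/
def bowtie : StructureType := fun V Q =>
  ∃ v : Fin 4 → Plane, Function.Injective v ∧ Set.range v = V ∧
    ConvexIndependent ℝ v ∧ ¬ IsSimpleFourGon v ∧ Q = fourGon v

/-- A pant: a simple 4-gon whose four vertices are in non-convex position. -/
def pant : StructureType := fun V Q =>
  ∃ v : Fin 4 → Plane, Function.Injective v ∧ Set.range v = V ∧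
    ¬ ConvexIndependent ℝ v ∧ IsSimpleFourGon v ∧ Q = fourGon v

/-- `Q` is a structure with a type in `S` that is induced by four points of `R` and contains no
further point of `R`. -/
def IsStructureOf (S : Set StructureType) (R : Set Plane) (Q : Set Plane) : Prop :=
  ∃ T ∈ S, ∃ V : Set Plane, V ⊆ R ∧ T V Q ∧ Q ∩ R = V

/-- The points of `B` block the points of `R`: every structure of `R` with a type in `S` contains
a point of `B`. -/
def Blocks (S : Set StructureType) (B R : Set Plane) : Prop :=
  ∀ Q : Set Plane, IsStructureOf S R Q → (Q ∩ B).Nonempty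

/-- The red points of `R` require at least `b` blue points to block all red structures with a type
in `S`. The blue points are distinct from the red ones, and all points together are in general
position. -/
def RequiresBlockers (S : Set StructureType) (R : Finset Plane) (b : ℕ) : Prop :=
  ∀ B : Finset Plane, Disjoint R B → GeneralPosition ((R : Set Plane) ∪ (B : Set Plane)) →
    Blocks S B R → b ≤ B.card

/-- Every set of `r` red points requires at least `b` blue points. -/
def Requires (S : Set StructureType) (r b : ℕ) : Prop :=
  ∀ R : Finset Plane, GeneralPosition (R : Set Plane) → R.card = r → RequiresBlockers S R b

/-- The size of the convex hull of a finite point set: the number of its vertices. -/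
noncomputable def hullSize (R : Finset Plane) : ℕ :=
  (Set.extremePoints ℝ (convexHull ℝ (R : Set Plane))).ncard

/-! Whether a point lies in a pant or bowtie depends only on orientations of triples. The region of
such a 4-gon is contained in a union of two triangles, star-shaped about a common point; by general
position a red or blue point of the region other than a vertex satisfies strict sign conditions. So
a blocking set satisfies the combinatorial condition `HitsAll`.

For up to six red points the rest is a finite computation. Take the lexicographically smallest point
as point 0 and number the others in angular order around it. All triples containing 0 are then
positive, and C(n-1,3) signs remain. For each sign pattern, the possible positions of one blue point
are over-approximated by the sign vectors on pairs of red points that satisfy the Grassmann–Plücker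
and affine sign conditions. Each position hits a certain set of structures, and a covering search
(`check`) shows that k such sets never cover all structures. This gives 2 blockers for four points,
4 for five points without `HasInnerPoint`, and 5 for six points (`needs_two`, `needs_four`,
`needs_five`). Five points with `HasInnerPoint` have hull size 4, so hull sizes 3 and 5 are covered.

Seven points are reduced to smaller sets. If a point sees two adjacent hull edges of the other six,
the pant beyond these edges costs a blocker of its own, which gives 5 + 1 (`Needs.of_erase`). If a
line through two points has a convex pentagon on one side and two further points on the other, the
two sides need separate blockers, which gives 4 + 2 (`Needs.of_split`). A truth table over all 2^20
sign patterns shows that one of these cases always occurs (`table_sevenPointCases`). -/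

/-! ### Orientations and half-planes -/

/-- Twice the signed area of the triangle `a b c`. -/
def cr (a b c : Plane) : ℝ := (b 0 - a 0) * (c 1 - a 1) - (b 1 - a 1) * (c 0 - a 0)

theorem cr_rotate (a b c : Plane) : cr b c a = cr a b c := by simp only [cr]; ring

theorem cr_swap (a b c : Plane) : cr b a c = -cr a b c := by simp only [cr]; ring

theorem cr_swap_right (a b c : Plane) : cr a c b = -cr a b c := by simp only [cr]; ring

theorem cr_self_left (a b : Plane) : cr a a b = 0 := by simp only [cr]; ring

theorem cr_self_right (a b : Plane) : cr a b b = 0 := by simp only [cr]; ring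

theorem cr_self_outer (a b : Plane) : cr a b a = 0 := by simp only [cr]; ring

theorem cr_combo (a b x y : Plane) (s t : ℝ) (h : s + t = 1) :
    cr a b (s • x + t • y) = s * cr a b x + t * cr a b y := by
  obtain rfl : s = 1 - t := by linarith
  simp only [cr, PiLp.add_apply, PiLp.smul_apply, smul_eq_mul]
  ring

/-- The closed half-plane on the left of the line through `a` and `b`. -/
def halfPlane (a b : Plane) : Set Plane := {x | 0 ≤ cr a b x}

theorem convex_halfPlane (a b : Plane) : Convex ℝ (halfPlane a b) := by
  intro x hx y hy s t hs ht hst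
  simp only [halfPlane, Set.mem_ofPred_eq] at hx hy ⊢
  rw [cr_combo a b x y s t hst]
  positivity

theorem collinear_of_cr_eq_zero {a b c : Plane} (h : cr a b c = 0) : Collinear ℝ {a, b, c} := by
  by_cases hab : a = b
  · subst hab
    simpa using collinear_pair ℝ a c
  have hne : (b 0 - a 0) ^ 2 + (b 1 - a 1) ^ 2 ≠ 0 := by
    intro h0
    apply hab
    have h1 : b 0 - a 0 = 0 := by nlinarith [sq_nonneg (b 0 - a 0), sq_nonneg (b 1 - a 1)]
    have h2 : b 1 - a 1 = 0 := by nlinarith [sq_nonneg (b 0 - a 0), sq_nonneg (b 1 - a 1)]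
    ext i
    fin_cases i
    · simp only [Fin.zero_eta]; linarith
    · simp only [Fin.mk_one]; linarith
  rw [collinear_iff_of_mem (p₀ := a) (by simp)]
  refine ⟨b - a, ?_⟩
  intro p hp
  simp only [Set.mem_insert_iff, Set.mem_singleton_iff] at hp
  rcases hp with rfl | rfl | rfl
  · exact ⟨0, by simp⟩
  · exact ⟨1, by simp⟩
  -- The coefficient of the orthogonal projection of `p - a` onto `b - a`.
  · refine ⟨((b 0 - a 0) * (p 0 - a 0) + (b 1 - a 1) * (p 1 - a 1)) /
      ((b 0 - a 0) ^ 2 + (b 1 - a 1) ^ 2), ?_⟩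
    simp only [cr] at h
    ext i
    fin_cases i
    · simp only [Fin.zero_eta, vadd_eq_add, PiLp.add_apply, PiLp.smul_apply, PiLp.sub_apply,
        smul_eq_mul]
      field_simp
      linear_combination (-(b 1 - a 1)) * h
    · simp only [Fin.mk_one, vadd_eq_add, PiLp.add_apply, PiLp.smul_apply, PiLp.sub_apply,
        smul_eq_mul]
      field_simp
      linear_combination (b 0 - a 0) * h

theorem GeneralPosition.cr_ne_zero {P : Set Plane} (h : GeneralPosition P) {a b c : Plane}
    (ha : a ∈ P) (hb : b ∈ P) (hc : c ∈ P) (hab : a ≠ b) (hac : a ≠ c) (hbc : b ≠ c) :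
    cr a b c ≠ 0 := fun h0 => h a ha b hb c hc hab hac hbc (collinear_of_cr_eq_zero h0)

/-- `x` lies in the interior of the triangle `a b c`. -/
def InTriangle (a b c x : Plane) : Prop :=
  (0 < cr a b x ∧ 0 < cr b c x ∧ 0 < cr c a x) ∨ (0 < cr b a x ∧ 0 < cr c b x ∧ 0 < cr a c x)

/-- `x` lies in the interior of the bowtie with crossing sides `ac` and `bd` and further sides `ab`
and `cd`. -/
def InBowtie (a b c d x : Plane) : Prop :=
  (0 < cr a b x ∧ 0 < cr c a x ∧ 0 < cr b d x) ∨ (0 < cr c d x ∧ 0 < cr a c x ∧ 0 < cr d b x)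

/-- `a b c d` is a counterclockwise convex quadrilateral. -/
def ConvexQuad (a b c d : Plane) : Prop :=
  0 < cr a b c ∧ 0 < cr b c d ∧ 0 < cr c d a ∧ 0 < cr d a b

theorem ne_of_cr_pos {a b c : Plane} (h : 0 < cr a b c) : a ≠ b ∧ a ≠ c ∧ b ≠ c := by
  refine ⟨?_, ?_, ?_⟩ <;> rintro rfl <;> simp [cr_self_left, cr_self_right, cr_self_outer] at h

theorem ConvexQuad.ne {a b c d : Plane} (h : ConvexQuad a b c d) :
    a ≠ b ∧ a ≠ c ∧ a ≠ d ∧ b ≠ c ∧ b ≠ d ∧ c ≠ d := by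
  obtain ⟨h1, h2, h3, h4⟩ := h
  have := ne_of_cr_pos h1
  have := ne_of_cr_pos h2
  have := ne_of_cr_pos h3
  have := ne_of_cr_pos h4
  tauto

/-- The sides `ac` and `bd` cross. -/
theorem exists_crossing {a b c d : Plane} (h1 : cr a c b < 0) (h2 : 0 < cr a c d)
    (h3 : 0 < cr b d a) (h4 : cr b d c < 0) :
    ∃ x, x ∈ segment ℝ a c ∧ x ∈ segment ℝ b d := by
  have hD : 0 < cr b d a - cr b d c := by linarith
  have hE : cr b d a - cr b d c = cr a c d - cr a c b := by simp only [cr]; ring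
  have hE' : 0 < cr a c d - cr a c b := by linarith
  -- The weight of an endpoint is proportional to the distance of the opposite endpoint from the
  -- line through the other side. By `hE` both denominators agree: they are twice the area of the
  -- quadrilateral.
  refine ⟨(-cr b d c / (cr b d a - cr b d c)) • a + (cr b d a / (cr b d a - cr b d c)) • c,
    ⟨_, _, div_nonneg (by linarith) hD.le, div_nonneg h3.le hD.le, ?_, rfl⟩,
    ⟨cr a c d / (cr a c d - cr a c b), -cr a c b / (cr a c d - cr a c b),
      div_nonneg h2.le hE'.le, div_nonneg (by linarith) hE'.le, ?_, ?_⟩⟩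
  · field_simp; ring
  · field_simp; ring
  · rw [hE]
    have hne : cr a c d - cr a c b ≠ 0 := hE'.ne'
    ext i
    fin_cases i
    · simp only [Fin.zero_eta, PiLp.add_apply, PiLp.smul_apply, smul_eq_mul]
      field_simp
      simp only [cr]; ring
    · simp only [Fin.mk_one, PiLp.add_apply, PiLp.smul_apply, smul_eq_mul]
      field_simp
      simp only [cr]; ring

/-! ### From closed 4-gons to sign conditions -/

/-- A region that is star-shaped and contains the boundary of a 4-gon contains the 4-gon. -/
theorem fourGon_subset {v : Fin 4 → Plane} {K : Set Plane} {o : Plane} (ho : o ∈ K)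
    (hK : StarConvex ℝ o K) (hv : fourGonBoundary v ⊆ K) : fourGon v ⊆ K := by
  intro p hp
  by_contra hpK
  have hpo : p ≠ o := fun h => hpK (h ▸ ho)
  rcases hp with hp | hp
  · exact hpK (hv hp)
  -- From `p` on, the ray from `o` through `p` avoids `K`, so it is a connected unbounded part of
  -- the complement of the curve.
  set ray : ℝ → Plane := fun t => o + t • (p - o) with hray
  have hout : ∀ t ∈ Set.Ici (1 : ℝ), ray t ∉ K := by
    intro t ht hmem
    have ht1 : (1 : ℝ) ≤ t := ht
    apply hpK
    have h0 : (0 : ℝ) < t := by linarith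
    have := hK hmem (a := 1 - t⁻¹) (b := t⁻¹) (by
      have := inv_le_one_of_one_le₀ ht1; linarith) (by positivity) (by ring)
    convert this using 1
    simp only [hray, smul_add, smul_smul, inv_mul_cancel₀ h0.ne', one_smul, sub_smul]
    abel
  have hcont : Continuous ray := by fun_prop
  have hconn : IsPreconnected (ray '' Set.Ici 1) :=
    (convex_Ici (1 : ℝ)).isPreconnected.image _ hcont.continuousOn
  have hmem : p ∈ ray '' Set.Ici 1 := ⟨1, by simp, by simp [hray]⟩
  have hsub : ray '' Set.Ici 1 ⊆ (fourGonBoundary v)ᶜ := by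
    rintro _ ⟨t, ht, rfl⟩ h
    exact hout t ht (hv h)
  have hb := hp.subset (hconn.subset_connectedComponentIn hmem hsub)
  obtain ⟨M, hM⟩ := hb.exists_norm_le
  have hpos : 0 < ‖p - o‖ := norm_pos_iff.2 (sub_ne_zero.2 hpo)
  have hM0 : 0 ≤ M := (norm_nonneg _).trans (hM p hmem)
  -- Chosen so that the point of the ray has norm at least `M + ‖p - o‖`.
  set t : ℝ := 1 + (M + ‖o‖) / ‖p - o‖ with ht
  have ht1 : 1 ≤ t := by
    rw [ht]; have : 0 ≤ (M + ‖o‖) / ‖p - o‖ := by positivity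
    linarith
  have h1 := hM (ray t) ⟨t, ht1, rfl⟩
  have h2 : ‖t • (p - o)‖ = t * ‖p - o‖ := by
    rw [norm_smul, Real.norm_of_nonneg (by linarith)]
  have h3 : ‖t • (p - o)‖ ≤ ‖ray t‖ + ‖o‖ := by
    have : t • (p - o) = ray t - o := by simp [hray]
    rw [this]; exact norm_sub_le _ _
  have h4 : t * ‖p - o‖ = ‖p - o‖ + (M + ‖o‖) := by
    rw [ht]; field_simp
  linarith

theorem mem_halfPlane_left (a b : Plane) : a ∈ halfPlane a b := (cr_self_outer a b).ge

theorem mem_halfPlane_right (a b : Plane) : b ∈ halfPlane a b := (cr_self_right a b).ge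

theorem segment_subset_halfPlane {a b c d : Plane} (hc : c ∈ halfPlane a b)
    (hd : d ∈ halfPlane a b) : segment ℝ c d ⊆ halfPlane a b :=
  (convex_halfPlane a b).segment_subset hc hd

theorem fourGonBoundary_subset {a b c d : Plane} {K : Set Plane} (h1 : segment ℝ a b ⊆ K)
    (h2 : segment ℝ b c ⊆ K) (h3 : segment ℝ c d ⊆ K) (h4 : segment ℝ d a ⊆ K) :
    fourGonBoundary ![a, b, c, d] ⊆ K := by
  refine Set.iUnion_subset fun i => ?_
  fin_cases i
  · exact h1
  · exact h2
  · exact h3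
  · exact h4

theorem vertex_mem_fourGon (v : Fin 4 → Plane) (i : Fin 4) : v i ∈ fourGon v :=
  Or.inl (Set.mem_iUnion.2 ⟨i, left_mem_segment ℝ _ _⟩)

/-- On a pair of distinct red points and a third red or blue point, weak inequalities are strict. -/
theorem GeneralPosition.pos_of_nonneg {P : Set Plane} (h : GeneralPosition P) {a b x : Plane}
    (ha : a ∈ P) (hb : b ∈ P) (hx : x ∈ P) (hab : a ≠ b) (hax : a ≠ x) (hbx : b ≠ x)
    (h0 : x ∈ halfPlane a b) : 0 < cr a b x :=
  lt_of_le_of_ne h0 (h.cr_ne_zero ha hb hx hab hax hbx).symm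

/-- The combinatorial content of `Blocks {pant, bowtie} B R`. -/
def HitsAll (B R : Finset Plane) : Prop :=
  (∀ a ∈ R, ∀ b ∈ R, ∀ c ∈ R, ∀ d ∈ R, ConvexQuad a b c d → (∀ r ∈ R, ¬ InBowtie a b c d r) →
    ∃ x ∈ B, InBowtie a b c d x) ∧
  (∀ d ∈ R, ∀ a ∈ R, ∀ b ∈ R, ∀ c ∈ R, InTriangle a b c d →
    (∀ r ∈ R, ¬ (InTriangle d a b r ∨ InTriangle d a c r)) →
    ∃ x ∈ B, InTriangle d a b x ∨ InTriangle d a c x)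

/-- A region `Q` that contains `V`, whose points in general position lie in the "interior" `I`, and
for which no red point lies in `I`, is blocked by a point in `I`. -/
theorem exists_blocker {S : Set StructureType} {T : StructureType} (hT : T ∈ S) {B R : Finset Plane}
    (hB : Blocks S B R) {V Q : Set Plane} (hTQ : T V Q) (hVR : V ⊆ R) (hVQ : V ⊆ Q)
    {I : Plane → Prop} (hI : ∀ x ∈ (R : Set Plane) ∪ (B : Set Plane), x ∈ Q → x ∉ V → I x)
    (hR : ∀ r ∈ R, ¬ I r) (hRB : Disjoint R B) : ∃ x ∈ B, I x := by
  obtain ⟨x, hxQ, hxB⟩ := hB Q ⟨T, hT, V, hVR, hTQ, by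
    apply Set.Subset.antisymm
    · rintro x ⟨hxQ, hxR⟩
      by_contra hxV
      exact hR x hxR (hI x (Or.inl hxR) hxQ hxV)
    · exact fun x hx => ⟨hVQ hx, hVR hx⟩⟩
  exact ⟨x, hxB, hI x (Or.inr hxB) hxQ fun hxV => Finset.disjoint_left.1 hRB (hVR hxV) hxB⟩

theorem injective_vec4 {a b c d : Plane} (h : a ≠ b ∧ a ≠ c ∧ a ≠ d ∧ b ≠ c ∧ b ≠ d ∧ c ≠ d) :
    Function.Injective ![a, b, c, d] := by
  obtain ⟨h1, h2, h3, h4, h5, h6⟩ := h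
  intro i j hij
  fin_cases i <;> fin_cases j <;> simp_all [eq_comm]

theorem notMem_convexHull_of_halfPlane {s : Set Plane} {a b x : Plane} (hs : s ⊆ halfPlane a b)
    (hx : cr a b x < 0) : x ∉ convexHull ℝ s := fun h =>
  absurd (convexHull_min hs (convex_halfPlane a b) h) (not_le.2 hx)

/-- The diagonal through the two neighbours of a vertex in the quadrilateral separates it from the
other vertices. -/
theorem convexIndependent_bowtie {a b c d : Plane} (h : ConvexQuad a b c d) :
    ConvexIndependent ℝ ![a, b, d, c] := by
  have hne := h.ne
  obtain ⟨h1, h2, h3, h4⟩ := h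
  have key : ∀ (i : Fin 4) (p q : Plane),
      (∀ j, j ≠ i → ![a, b, d, c] j ∈ halfPlane p q) → cr p q (![a, b, d, c] i) < 0 →
      ∀ s : Set (Fin 4), ![a, b, d, c] i ∈ convexHull ℝ (![a, b, d, c] '' s) → i ∈ s := by
    intro i p q hj hi s hs
    by_contra his
    refine notMem_convexHull_of_halfPlane ?_ hi hs
    rintro _ ⟨j, hjs, rfl⟩
    exact hj j fun hji => his (hji ▸ hjs)
  simp only [cr] at h1 h2 h3 h4
  intro s i hs
  fin_cases i
  · refine key 0 d b (fun j hj => ?_) (show cr d b a < 0 by simp only [cr]; linarith) s hs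
    fin_cases j
    · exact absurd rfl hj
    · exact mem_halfPlane_right d b
    · exact mem_halfPlane_left d b
    · exact (show 0 ≤ cr d b c by simp only [cr]; linarith)
  · refine key 1 a c (fun j hj => ?_) (show cr a c b < 0 by simp only [cr]; linarith) s hs
    fin_cases j
    · exact mem_halfPlane_left a c
    · exact absurd rfl hj
    · exact (show 0 ≤ cr a c d by simp only [cr]; linarith)
    · exact mem_halfPlane_right a c
  · refine key 2 c a (fun j hj => ?_) (show cr c a d < 0 by simp only [cr]; linarith) s hs
    fin_cases j
    · exact mem_halfPlane_right c a
    · exact (show 0 ≤ cr c a b by simp only [cr]; linarith)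
    · exact absurd rfl hj
    · exact mem_halfPlane_left c a
  · refine key 3 b d (fun j hj => ?_) (show cr b d c < 0 by simp only [cr]; linarith) s hs
    fin_cases j
    · exact (show 0 ≤ cr b d a by simp only [cr]; linarith)
    · exact mem_halfPlane_left b d
    · exact mem_halfPlane_right b d
    · exact absurd rfl hj

theorem range_vec4 (a b c d : Plane) : Set.range ![a, b, c, d] = {a, b, c, d} := by
  ext x
  simp [eq_comm]
  tauto

/-- The crossing point `o` is common to the triangles `K₁` = `abo` and `K₂` = `cdo`, so their union
is star-shaped about `o` and contains the region. -/
theorem exists_inBowtie {B R : Finset Plane} (hRB : Disjoint R B)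
    (hGP : GeneralPosition ((R : Set Plane) ∪ (B : Set Plane)))
    (hB : Blocks {pant, bowtie} B R) {a b c d : Plane} (ha : a ∈ R) (hb : b ∈ R) (hc : c ∈ R)
    (hd : d ∈ R) (h : ConvexQuad a b c d) (hR : ∀ r ∈ R, ¬ InBowtie a b c d r) :
    ∃ x ∈ B, InBowtie a b c d x := by
  have hne := h.ne
  have hci := convexIndependent_bowtie h
  obtain ⟨h1, h2, h3, h4⟩ := h
  have e1 : cr a c b < 0 := by simp only [cr] at *; linarith
  have e2 : 0 < cr a c d := by simp only [cr] at *; linarith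
  have e3 : 0 < cr b d a := by simp only [cr] at *; linarith
  have e4 : cr b d c < 0 := by simp only [cr] at *; linarith
  have e5 : 0 < cr a b d := by simp only [cr] at *; linarith
  have e6 : 0 < cr c d b := by simp only [cr] at *; linarith
  have e7 : 0 < cr c a b := by simp only [cr] at *; linarith
  have e8 : 0 < cr d b c := by simp only [cr] at *; linarith
  obtain ⟨o, hoac, hobd⟩ := exists_crossing e1 e2 e3 e4
  set K₁ : Set Plane := halfPlane a b ∩ halfPlane c a ∩ halfPlane b d with hK₁
  set K₂ : Set Plane := halfPlane c d ∩ halfPlane a c ∩ halfPlane d b with hK₂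
  have c₁ : Convex ℝ K₁ :=
    ((convex_halfPlane _ _).inter (convex_halfPlane _ _)).inter (convex_halfPlane _ _)
  have c₂ : Convex ℝ K₂ :=
    ((convex_halfPlane _ _).inter (convex_halfPlane _ _)).inter (convex_halfPlane _ _)
  have ma := mem_halfPlane_left
  have mb := mem_halfPlane_right
  have o₁ : o ∈ K₁ := ⟨⟨segment_subset_halfPlane (ma a b) h1.le hoac,
    segment_subset_halfPlane (mb c a) (ma c a) hoac⟩,
    segment_subset_halfPlane (ma b d) (mb b d) hobd⟩
  have o₂ : o ∈ K₂ := ⟨⟨segment_subset_halfPlane h3.le (ma c d) hoac,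
    segment_subset_halfPlane (ma a c) (mb a c) hoac⟩,
    segment_subset_halfPlane (mb d b) (ma d b) hobd⟩
  have a₁ : a ∈ K₁ := ⟨⟨ma a b, mb c a⟩, e3.le⟩
  have b₁ : b ∈ K₁ := ⟨⟨mb a b, e7.le⟩, ma b d⟩
  have c₂' : c ∈ K₂ := ⟨⟨ma c d, mb a c⟩, e8.le⟩
  have d₂ : d ∈ K₂ := ⟨⟨mb c d, e2.le⟩, ma d b⟩
  have hstar : StarConvex ℝ o (K₁ ∪ K₂) := (c₁.starConvex o₁).union (c₂.starConvex o₂)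
  -- A crossing side passes from one triangle to the other at `o`; the line through the other
  -- crossing side decides in which of them a point lies.
  have hsplit : ∀ x, x ∈ halfPlane c a ∨ x ∈ halfPlane a c := by
    intro x
    have : cr c a x = -cr a c x := cr_swap _ _ _
    rcases le_total 0 (cr c a x) with h | h
    · exact Or.inl h
    · exact Or.inr (show 0 ≤ cr a c x by linarith)
  have hsplit' : ∀ x, x ∈ halfPlane b d ∨ x ∈ halfPlane d b := by
    intro x
    have : cr b d x = -cr d b x := cr_swap _ _ _
    rcases le_total 0 (cr b d x) with h | h
    · exact Or.inl h
    · exact Or.inr (show 0 ≤ cr d b x by linarith)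
  have hbd : segment ℝ b d ⊆ K₁ ∪ K₂ := by
    intro x hx
    rcases hsplit x with h | h
    · exact Or.inl ⟨⟨segment_subset_halfPlane (mb a b) e5.le hx, h⟩,
        segment_subset_halfPlane (ma b d) (mb b d) hx⟩
    · exact Or.inr ⟨⟨segment_subset_halfPlane e6.le (mb c d) hx, h⟩,
        segment_subset_halfPlane (mb d b) (ma d b) hx⟩
  have hca : segment ℝ c a ⊆ K₁ ∪ K₂ := by
    intro x hx
    rcases hsplit' x with h | h
    · exact Or.inl ⟨⟨segment_subset_halfPlane h1.le (ma a b) hx,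
        segment_subset_halfPlane (ma c a) (mb c a) hx⟩, h⟩
    · exact Or.inr ⟨⟨segment_subset_halfPlane (ma c d) h3.le hx,
        segment_subset_halfPlane (mb a c) (ma a c) hx⟩, h⟩
  have hsub : fourGon ![a, b, d, c] ⊆ K₁ ∪ K₂ := by
    refine fourGon_subset (Or.inl o₁) hstar (fourGonBoundary_subset ?_ hbd ?_ hca)
    · exact (c₁.segment_subset a₁ b₁).trans Set.subset_union_left
    · exact (c₂.segment_subset d₂ c₂').trans Set.subset_union_right
  have hT : bowtie (Set.range ![a, b, d, c]) (fourGon ![a, b, d, c]) := by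
    refine ⟨_, injective_vec4 (by tauto), rfl, hci, fun hs => ?_, rfl⟩
    refine Set.disjoint_left.1 (hs 1).2 hobd ?_
    rw [segment_symm] at hoac
    exact hoac
  refine exists_blocker (T := bowtie) (by simp) hB hT ?_ ?_ (I := InBowtie a b c d) ?_ hR hRB
  · rw [range_vec4]; intro x hx
    simp only [Set.mem_insert_iff, Set.mem_singleton_iff] at hx
    rcases hx with rfl | rfl | rfl | rfl <;> assumption
  · rintro _ ⟨i, rfl⟩; exact vertex_mem_fourGon _ i
  · intro x hx hxQ hxV
    rw [range_vec4] at hxV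
    simp only [Set.mem_insert_iff, Set.mem_singleton_iff, not_or] at hxV
    obtain ⟨xa, xb, xd, xc⟩ := hxV
    have ha' : a ∈ (R : Set Plane) ∪ B := Or.inl ha
    have hb' : b ∈ (R : Set Plane) ∪ B := Or.inl hb
    have hc' : c ∈ (R : Set Plane) ∪ B := Or.inl hc
    have hd' : d ∈ (R : Set Plane) ∪ B := Or.inl hd
    obtain ⟨n1, n2, n3, n4, n5, n6⟩ := hne
    rcases hsub hxQ with ⟨⟨k1, k2⟩, k3⟩ | ⟨⟨k1, k2⟩, k3⟩
    · exact Or.inl ⟨hGP.pos_of_nonneg ha' hb' hx n1 (Ne.symm xa) (Ne.symm xb) k1,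
        hGP.pos_of_nonneg hc' ha' hx n2.symm (Ne.symm xc) (Ne.symm xa) k2,
        hGP.pos_of_nonneg hb' hd' hx n5 (Ne.symm xb) (Ne.symm xd) k3⟩
    · exact Or.inr ⟨hGP.pos_of_nonneg hc' hd' hx n6 (Ne.symm xc) (Ne.symm xd) k1,
        hGP.pos_of_nonneg ha' hc' hx n2 (Ne.symm xa) (Ne.symm xc) k2,
        hGP.pos_of_nonneg hd' hb' hx n5.symm (Ne.symm xd) (Ne.symm xb) k3⟩

theorem segment_inter_segment_of_cr_ne_zero {a b c : Plane} (h : cr a b c ≠ 0) :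
    segment ℝ a b ∩ segment ℝ b c = {b} := by
  apply Set.Subset.antisymm
  · rintro x ⟨⟨s, t, hs, ht, hst, rfl⟩, ⟨s', t', hs', ht', hst', hx⟩⟩
    have h1 : cr a b (s • a + t • b) = 0 := by
      rw [cr_combo a b a b s t hst, cr_self_outer, cr_self_right]; ring
    rw [← hx, cr_combo a b b c s' t' hst', cr_self_right] at h1
    have : t' = 0 := by simpa [h] using h1
    subst this
    have hs1 : s' = 1 := by linarith
    rw [← hx, hs1]
    simp
  · rintro x rfl
    exact ⟨right_mem_segment ℝ _ _, left_mem_segment ℝ _ _⟩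

theorem disjoint_segment_of_cr_pos {a b c d : Plane} (hc : 0 < cr a b c) (hd : 0 < cr a b d) :
    Disjoint (segment ℝ a b) (segment ℝ c d) := by
  rw [Set.disjoint_left]
  rintro x ⟨s, t, hs, ht, hst, rfl⟩ ⟨s', t', hs', ht', hst', hx⟩
  have h1 : cr a b (s • a + t • b) = 0 := by
    rw [cr_combo a b a b s t hst, cr_self_outer, cr_self_right]; ring
  rw [← hx, cr_combo a b c d s' t' hst'] at h1
  rcases hs'.eq_or_lt with rfl | hs0
  · have : t' = 1 := by linarith
    subst this; linarith
  · have := mul_pos hs0 hc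
    have := mul_nonneg ht' hd.le
    linarith

/-- The sides `ab` and `ca` are edges of the triangle; the side opposite to each has both endpoints
strictly to its left. -/
theorem isSimpleFourGon_pant {a b c d : Plane} (h1 : 0 < cr a b d) (h2 : 0 < cr b c d)
    (h3 : 0 < cr c a d) : IsSimpleFourGon ![a, b, d, c] := by
  have h : 0 < cr a b c := by simp only [cr] at *; linarith
  intro i
  fin_cases i
  · exact ⟨segment_inter_segment_of_cr_ne_zero h1.ne',
      disjoint_segment_of_cr_pos h1 h⟩
  · refine ⟨segment_inter_segment_of_cr_ne_zero (show cr b d c ≠ 0 from ?_), ?_⟩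
    · simp only [cr] at *; intro h0; linarith
    · exact (disjoint_segment_of_cr_pos (show 0 < cr c a b by simp only [cr] at *; linarith)
        h3).symm
  · refine ⟨segment_inter_segment_of_cr_ne_zero (show cr d c a ≠ 0 from ?_), ?_⟩
    · simp only [cr] at *; intro h0; linarith
    · exact (disjoint_segment_of_cr_pos h1 h).symm
  · refine ⟨segment_inter_segment_of_cr_ne_zero (show cr c a b ≠ 0 from ?_), ?_⟩
    · simp only [cr] at *; intro h0; linarith
    · exact disjoint_segment_of_cr_pos (show 0 < cr c a b by simp only [cr] at *; linarith) h3

/-- The barycentric coordinates are the ratios of the areas of the three small triangles to the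
whole. -/
theorem mem_convexHull_of_cr_pos {a b c d : Plane} (h1 : 0 < cr a b d) (h2 : 0 < cr b c d)
    (h3 : 0 < cr c a d) : d ∈ convexHull ℝ {a, b, c} := by
  have hsum : cr a b c = cr a b d + cr b c d + cr c a d := by simp only [cr]; ring
  have hpos : 0 < cr a b c := by linarith
  have hd : d = (cr b c d / cr a b c) • a + (cr c a d / cr a b c) • b +
      (cr a b d / cr a b c) • c := by
    have hne := hpos.ne'
    ext i
    fin_cases i
    · simp only [Fin.zero_eta, PiLp.add_apply, PiLp.smul_apply, smul_eq_mul]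
      field_simp
      simp only [cr]; ring
    · simp only [Fin.mk_one, PiLp.add_apply, PiLp.smul_apply, smul_eq_mul]
      field_simp
      simp only [cr]; ring
  have := (convex_convexHull ℝ {a, b, c}).sum_mem (t := Finset.univ)
    (w := ![cr b c d / cr a b c, cr c a d / cr a b c, cr a b d / cr a b c]) (z := ![a, b, c])
    (by
      intro i _
      fin_cases i
      · exact div_nonneg h2.le hpos.le
      · exact div_nonneg h3.le hpos.le
      · exact div_nonneg h1.le hpos.le)
    (by
      simp only [Fin.sum_univ_three, Matrix.cons_val]
      field_simp
      linarith)
    (by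
      intro i _
      apply subset_convexHull
      fin_cases i <;> simp)
  rw [hd]
  simpa only [Fin.sum_univ_three, Matrix.cons_val] using this

theorem not_convexIndependent_pant {a b c d : Plane} (h1 : 0 < cr a b d) (h2 : 0 < cr b c d)
    (h3 : 0 < cr c a d) : ¬ ConvexIndependent ℝ ![a, b, d, c] := by
  intro h
  have h4 := h {0, 1, 3} 2 (by
    have := mem_convexHull_of_cr_pos h1 h2 h3
    convert this using 2
    · rw [Set.image_insert_eq, Set.image_pair]
      rfl
    · rfl)
  simp at h4

/-- The segment `da` from the reflex vertex `d` cuts the pant into the triangles `K₁` and `K₂`, and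
their union is star-shaped about `d`. -/
theorem exists_inPant {B R : Finset Plane} (hRB : Disjoint R B)
    (hGP : GeneralPosition ((R : Set Plane) ∪ (B : Set Plane)))
    (hB : Blocks {pant, bowtie} B R) {d a b c : Plane} (hd : d ∈ R) (ha : a ∈ R) (hb : b ∈ R)
    (hc : c ∈ R) (h1 : 0 < cr a b d) (h2 : 0 < cr b c d) (h3 : 0 < cr c a d)
    (hR : ∀ r ∈ R, ¬ (InTriangle d a b r ∨ InTriangle d a c r)) :
    ∃ x ∈ B, InTriangle d a b x ∨ InTriangle d a c x := by
  obtain ⟨n1, n2, n3⟩ := ne_of_cr_pos h1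
  obtain ⟨n4, n5, n6⟩ := ne_of_cr_pos h2
  obtain ⟨n7, -, -⟩ := ne_of_cr_pos h3
  have ma := mem_halfPlane_left
  have mb := mem_halfPlane_right
  set K₁ : Set Plane := halfPlane a b ∩ halfPlane b d ∩ halfPlane d a with hK₁
  set K₂ : Set Plane := halfPlane a d ∩ halfPlane d c ∩ halfPlane c a with hK₂
  have c₁ : Convex ℝ K₁ :=
    ((convex_halfPlane _ _).inter (convex_halfPlane _ _)).inter (convex_halfPlane _ _)
  have c₂ : Convex ℝ K₂ :=
    ((convex_halfPlane _ _).inter (convex_halfPlane _ _)).inter (convex_halfPlane _ _)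
  have rot : ∀ x y z : Plane, 0 < cr x y z → 0 < cr y z x := fun x y z h => by
    rwa [cr_rotate]
  have d₁ : d ∈ K₁ := ⟨⟨h1.le, mb b d⟩, ma d a⟩
  have d₂ : d ∈ K₂ := ⟨⟨mb a d, ma d c⟩, h3.le⟩
  have a₁ : a ∈ K₁ := ⟨⟨ma a b, (rot _ _ _ h1).le⟩, mb d a⟩
  have a₂ : a ∈ K₂ := ⟨⟨ma a d, (rot _ _ _ (rot _ _ _ h3)).le⟩, mb c a⟩
  have b₁ : b ∈ K₁ := ⟨⟨mb a b, ma b d⟩, (rot _ _ _ (rot _ _ _ h1)).le⟩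
  have c₂' : c ∈ K₂ := ⟨⟨(rot _ _ _ h3).le, mb d c⟩, ma c a⟩
  have hsub : fourGon ![a, b, d, c] ⊆ K₁ ∪ K₂ := by
    refine fourGon_subset (Or.inl d₁) ((c₁.starConvex d₁).union (c₂.starConvex d₂))
      (fourGonBoundary_subset ?_ ?_ ?_ ?_)
    · exact (c₁.segment_subset a₁ b₁).trans Set.subset_union_left
    · exact (c₁.segment_subset b₁ d₁).trans Set.subset_union_left
    · exact (c₂.segment_subset d₂ c₂').trans Set.subset_union_right
    · exact (c₂.segment_subset c₂' a₂).trans Set.subset_union_right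
  have hT : pant (Set.range ![a, b, d, c]) (fourGon ![a, b, d, c]) :=
    ⟨_, injective_vec4 ⟨n1, n2, n7.symm, n5, n4, n6.symm⟩, rfl,
      not_convexIndependent_pant h1 h2 h3, isSimpleFourGon_pant h1 h2 h3, rfl⟩
  refine exists_blocker (T := pant) (by simp) hB hT ?_ ?_
    (I := fun x => InTriangle d a b x ∨ InTriangle d a c x) ?_ hR hRB
  · rw [range_vec4]; intro x hx
    simp only [Set.mem_insert_iff, Set.mem_singleton_iff] at hx
    rcases hx with rfl | rfl | rfl | rfl <;> assumption
  · rintro _ ⟨i, rfl⟩; exact vertex_mem_fourGon _ i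
  · intro x hx hxQ hxV
    rw [range_vec4] at hxV
    simp only [Set.mem_insert_iff, Set.mem_singleton_iff, not_or] at hxV
    obtain ⟨xa, xb, xd, xc⟩ := hxV
    have ha' : a ∈ (R : Set Plane) ∪ B := Or.inl ha
    have hb' : b ∈ (R : Set Plane) ∪ B := Or.inl hb
    have hc' : c ∈ (R : Set Plane) ∪ B := Or.inl hc
    have hd' : d ∈ (R : Set Plane) ∪ B := Or.inl hd
    rcases hsub hxQ with ⟨⟨k1, k2⟩, k3⟩ | ⟨⟨k1, k2⟩, k3⟩
    · exact Or.inl (Or.inl ⟨hGP.pos_of_nonneg hd' ha' hx n2.symm (Ne.symm xd) (Ne.symm xa) k3,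
        hGP.pos_of_nonneg ha' hb' hx n1 (Ne.symm xa) (Ne.symm xb) k1,
        hGP.pos_of_nonneg hb' hd' hx n3 (Ne.symm xb) (Ne.symm xd) k2⟩)
    · exact Or.inr (Or.inr ⟨hGP.pos_of_nonneg ha' hd' hx n2 (Ne.symm xa) (Ne.symm xd) k1,
        hGP.pos_of_nonneg hc' ha' hx n7 (Ne.symm xc) (Ne.symm xa) k3,
        hGP.pos_of_nonneg hd' hc' hx n6.symm (Ne.symm xd) (Ne.symm xc) k2⟩)

theorem Blocks.hitsAll {B R : Finset Plane} (hB : Blocks {pant, bowtie} B R) (hRB : Disjoint R B)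
    (hGP : GeneralPosition ((R : Set Plane) ∪ (B : Set Plane))) : HitsAll B R := by
  refine ⟨fun a ha b hb c hc d hd h hR => exists_inBowtie hRB hGP hB ha hb hc hd h hR,
    fun d hd a ha b hb c hc h hR => ?_⟩
  rcases h with ⟨h1, h2, h3⟩ | ⟨h1, h2, h3⟩
  · exact exists_inPant hRB hGP hB hd ha hb hc h1 h2 h3 hR
  -- For a clockwise triangle, exchanging `b` and `c` restores the orientation and only swaps the
  -- two halves of the pant.
  · obtain ⟨x, hx, h⟩ := exists_inPant hRB hGP hB hd ha hc hb h3 h2 h1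
      fun r hr h => hR r hr h.symm
    exact ⟨x, hx, h.symm⟩

/-! ### Five points with an inner point have four hull vertices -/

/-- One of the five points lies in a triangle spanned by three vertices of a convex quadrilateral
formed by the others. -/
def HasInnerPoint (R : Finset Plane) : Prop :=
  ∃ a ∈ R, ∃ b ∈ R, ∃ c ∈ R, ∃ d ∈ R, ∃ x ∈ R, ConvexQuad a b c d ∧
    0 < cr a b x ∧ 0 < cr b c x ∧ 0 < cr c a x

/-- Two supporting lines meet only in `a`. If `a` lies inside a segment of the hull, both linear
conditions must be tight at its endpoints, which therefore equal `a`. -/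
theorem mem_extremePoints_of_halfPlane {S : Set Plane} {a b d : Plane} (ha : a ∈ S)
    (h1 : S ⊆ halfPlane a b) (h2 : S ⊆ halfPlane d a) (hne : 0 < cr d a b) :
    a ∈ (convexHull ℝ S).extremePoints ℝ := by
  rw [mem_extremePoints_iff_left]
  refine ⟨subset_convexHull ℝ S ha, fun x hx y hy hxy => ?_⟩
  obtain ⟨s, t, hs, ht, hst, he⟩ := hxy
  have x1 : 0 ≤ cr a b x := convexHull_min h1 (convex_halfPlane a b) hx
  have x2 : 0 ≤ cr d a x := convexHull_min h2 (convex_halfPlane d a) hx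
  have y1 : 0 ≤ cr a b y := convexHull_min h1 (convex_halfPlane a b) hy
  have y2 : 0 ≤ cr d a y := convexHull_min h2 (convex_halfPlane d a) hy
  have e1 : s * cr a b x + t * cr a b y = 0 := by
    rw [← cr_combo a b x y s t hst, he, cr_self_outer]
  have e2 : s * cr d a x + t * cr d a y = 0 := by
    rw [← cr_combo d a x y s t hst, he, cr_self_right]
  have z1 : cr a b x = 0 := by
    have : s * cr a b x = 0 := by nlinarith [mul_nonneg hs.le x1, mul_nonneg ht.le y1]
    simpa [hs.ne'] using this
  have z2 : cr d a x = 0 := by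
    have : s * cr d a x = 0 := by nlinarith [mul_nonneg hs.le x2, mul_nonneg ht.le y2]
    simpa [hs.ne'] using this
  simp only [cr] at z1 z2 hne
  have k0 : cr d a b * (x 0 - a 0) = 0 := by
    simp only [cr]
    linear_combination (b 0 - a 0) * z2 - (a 0 - d 0) * z1
  have k1 : cr d a b * (x 1 - a 1) = 0 := by
    simp only [cr]
    linear_combination (b 1 - a 1) * z2 - (a 1 - d 1) * z1
  have hne' : cr d a b ≠ 0 := by simp only [cr]; exact hne.ne'
  ext i
  fin_cases i
  · exact sub_eq_zero.1 ((mul_eq_zero.1 k0).resolve_left hne')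
  · exact sub_eq_zero.1 ((mul_eq_zero.1 k1).resolve_left hne')

theorem hullSize_eq_four {R : Finset Plane} (hR : R.card = 5) (h : HasInnerPoint R) :
    hullSize R = 4 := by
  obtain ⟨a, ha, b, hb, c, hc, d, hd, x, hx, hq, hx1, hx2, hx3⟩ := h
  obtain ⟨n1, n2, n3, n4, n5, n6⟩ := hq.ne
  obtain ⟨q1, q2, q3, q4⟩ := hq
  obtain ⟨-, m1, m2⟩ := ne_of_cr_pos hx1
  obtain ⟨-, -, m3⟩ := ne_of_cr_pos hx2
  -- The line `ca` separates `x` from `d`.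
  have m4 : x ≠ d := by
    rintro rfl
    have : cr c a x = -cr c x a := cr_swap_right _ _ _
    linarith
  have hRe : R = {a, b, c, d, x} := by
    symm
    apply Finset.eq_of_subset_of_card_le
    · intro y hy
      simp only [Finset.mem_insert, Finset.mem_singleton] at hy
      rcases hy with rfl | rfl | rfl | rfl | rfl <;> assumption
    · rw [hR]
      have : ({a, b, c, d, x} : Finset Plane).card = 5 := by
        rw [Finset.card_insert_of_notMem, Finset.card_insert_of_notMem,
          Finset.card_insert_of_notMem, Finset.card_insert_of_notMem, Finset.card_singleton] <;>
        simp_all [eq_comm]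
      rw [this]
  have hxh : x ∈ convexHull ℝ ({a, b, c, d} : Set Plane) :=
    convexHull_mono (by intro y; simp only [Set.mem_insert_iff, Set.mem_singleton_iff]; tauto)
      (mem_convexHull_of_cr_pos hx1 hx2 hx3)
  have hS : convexHull ℝ (R : Set Plane) = convexHull ℝ ({a, b, c, d} : Set Plane) := by
    rw [hRe]
    apply Set.Subset.antisymm
    · apply convexHull_min _ (convex_convexHull ℝ _)
      intro y hy
      simp only [Finset.coe_insert, Finset.coe_singleton, Set.mem_insert_iff,
        Set.mem_singleton_iff] at hy
      rcases hy with rfl | rfl | rfl | rfl | rfl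
      on_goal 5 => exact hxh
      all_goals exact subset_convexHull ℝ _ (by simp)
    · apply convexHull_mono
      intro y
      simp only [Finset.coe_insert, Finset.coe_singleton, Set.mem_insert_iff,
        Set.mem_singleton_iff]
      tauto
  have hhalf : ∀ p q : Plane, 0 ≤ cr p q a → 0 ≤ cr p q b → 0 ≤ cr p q c → 0 ≤ cr p q d →
      ({a, b, c, d} : Set Plane) ⊆ halfPlane p q := by
    intro p q h1 h2 h3 h4 y hy
    simp only [Set.mem_insert_iff, Set.mem_singleton_iff] at hy
    rcases hy with rfl | rfl | rfl | rfl <;> assumption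
  have hab : ({a, b, c, d} : Set Plane) ⊆ halfPlane a b := by
    apply hhalf <;> simp only [cr] at * <;> linarith
  have hbc : ({a, b, c, d} : Set Plane) ⊆ halfPlane b c := by
    apply hhalf <;> simp only [cr] at * <;> linarith
  have hcd : ({a, b, c, d} : Set Plane) ⊆ halfPlane c d := by
    apply hhalf <;> simp only [cr] at * <;> linarith
  have hda : ({a, b, c, d} : Set Plane) ⊆ halfPlane d a := by
    apply hhalf <;> simp only [cr] at * <;> linarith
  have hext : (convexHull ℝ (R : Set Plane)).extremePoints ℝ = {a, b, c, d} := by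
    rw [hS]
    apply Set.Subset.antisymm extremePoints_convexHull_subset
    intro y hy
    simp only [Set.mem_insert_iff, Set.mem_singleton_iff] at hy
    rcases hy with rfl | rfl | rfl | rfl
    · exact mem_extremePoints_of_halfPlane (by simp) hab hda q4
    · exact mem_extremePoints_of_halfPlane (by simp) hbc hab q1
    · exact mem_extremePoints_of_halfPlane (by simp) hcd hbc q2
    · exact mem_extremePoints_of_halfPlane (by simp) hda hcd q3
  rw [hullSize, hext]
  have : ({a, b, c, d} : Set Plane) = (({a, b, c, d} : Finset Plane) : Set Plane) := by simp
  rw [this, Set.ncard_coe_finset]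
  rw [Finset.card_insert_of_notMem, Finset.card_insert_of_notMem,
    Finset.card_insert_of_notMem, Finset.card_singleton] <;> simp [n1, n2, n3, n4, n5, n6]

/-! ### Angular labelling around an extreme point -/

/-- `x` is lexicographically greater than `o`. -/
def LexGreater (o x : Plane) : Prop := o 0 < x 0 ∨ (o 0 = x 0 ∧ o 1 < x 1)

/-- Seen from `o`, the directions to lexicographically greater points lie in (-π/2, π/2], where the
counterclockwise order is transitive. The identity `key` shows this unless `v` is straight above
`o`; that direction is the last one, so no `w` can follow. -/
theorem cr_pos_trans {o u v w : Plane} (hu : LexGreater o u) (hv : LexGreater o v)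
    (hw : LexGreater o w) (h1 : 0 < cr o u v) (h2 : 0 < cr o v w) : 0 < cr o u w := by
  have key : (v 0 - o 0) * cr o u w = (u 0 - o 0) * cr o v w + (w 0 - o 0) * cr o u v := by
    simp only [cr]; ring
  have nonneg : ∀ x, LexGreater o x → 0 ≤ x 0 - o 0 := by
    rintro x (h | ⟨h, -⟩) <;> linarith
  have hu0 := nonneg u hu
  have hw0 := nonneg w hw
  rcases hv with hv | ⟨hv, hv'⟩
  · have hv0 : 0 < v 0 - o 0 := by linarith
    refine pos_of_mul_pos_right (lt_of_lt_of_eq ?_ key.symm) hv0.le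
    rcases hu0.eq_or_lt with hu1 | hu1
    · rcases hw0.eq_or_lt with hw1 | hw1
      · exfalso
        rcases hu with hu | ⟨-, hu⟩
        · linarith
        · simp only [cr] at h1
          rw [← hu1] at h1
          nlinarith
      · have := mul_pos hw1 h1
        have := mul_nonneg hu0 h2.le
        linarith
    · have := mul_pos hu1 h2
      have := mul_nonneg hw0 h1.le
      linarith
  · exfalso
    simp only [cr] at h2
    rw [← hv] at h2
    nlinarith

/-- A finite set in general position can be listed such that the first point is a vertex of the
convex hull, and the other points follow in angular order around it. -/
theorem exists_labelling {R : Finset Plane} (hGP : GeneralPosition (R : Set Plane)) {n : ℕ}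
    (hn : 0 < n) (hR : R.card = n) :
    ∃ p : ℕ → Plane, (Finset.range n).image p = R ∧ Set.InjOn p (Set.Iio n) ∧
      ∀ j k, 0 < j → j < k → k < n → 0 < cr (p 0) (p j) (p k) := by
  classical
  obtain ⟨o, ho, hmin⟩ := R.exists_min_image (fun x => toLex (x 0, x 1))
    (Finset.card_pos.1 (hR ▸ hn))
  have hlex : ∀ x ∈ R.erase o, LexGreater o x := by
    intro x hx
    rw [Finset.mem_erase] at hx
    have := hmin x hx.2
    rw [Prod.Lex.le_iff] at this
    rcases this with h | ⟨h, h'⟩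
    · exact Or.inl h
    · refine Or.inr ⟨h, lt_of_le_of_ne h' fun h1 => hx.1 ?_⟩
      ext i
      fin_cases i
      · exact h.symm
      · exact h1.symm
  let r : R.erase o → R.erase o → Prop := fun x y => x = y ∨ 0 < cr o x y
  have hne : ∀ x y : R.erase o, x ≠ y → cr o x y ≠ 0 := by
    intro x y hxy
    have hx := Finset.mem_erase.1 x.2
    have hy := Finset.mem_erase.1 y.2
    exact hGP.cr_ne_zero ho hx.2 hy.2 (Ne.symm hx.1) (Ne.symm hy.1) fun h => hxy (Subtype.ext h)
  have : IsTrans (R.erase o) r := ⟨by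
    rintro x y z (rfl | hxy) (rfl | hyz)
    · exact Or.inl rfl
    · exact Or.inr hyz
    · exact Or.inr hxy
    · exact Or.inr (cr_pos_trans (hlex x x.2) (hlex y y.2) (hlex z z.2) hxy hyz)⟩
  have : Std.Antisymm r := ⟨by
    rintro x y (h | h) (h' | h')
    · exact h
    · exact h
    · exact h'.symm
    · have : cr o x y = -cr o y x := cr_swap_right _ _ _
      linarith⟩
  have : Std.Total r := ⟨by
    intro x y
    by_cases hxy : x = y
    · exact Or.inl (Or.inl hxy)
    · have : cr o x y = -cr o y x := cr_swap_right _ _ _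
      rcases (hne x y hxy).lt_or_gt with h | h
      · exact Or.inr (Or.inr (by linarith))
      · exact Or.inl (Or.inr h)⟩
  set l : List (R.erase o) := Finset.univ.sort r with hl
  have hlen : l.length = n - 1 := by
    rw [hl, Finset.length_sort, Finset.card_univ, Fintype.card_coe, Finset.card_erase_of_mem ho, hR]
  have hnd : l.Nodup := Finset.sort_nodup _ _
  have hpw : l.Pairwise r := Finset.pairwise_sort _ _
  set L : List Plane := o :: l.map Subtype.val with hL
  have hLlen : L.length = n := by simp [hL, hlen]; omega
  have hLnd : L.Nodup := by
    rw [hL, List.nodup_cons]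
    refine ⟨?_, hnd.map Subtype.val_injective⟩
    rw [List.mem_map]
    rintro ⟨x, -, hx⟩
    exact (Finset.mem_erase.1 x.2).1 hx
  have hLR : L.toFinset = R := by
    ext x
    rw [List.mem_toFinset, hL, List.mem_cons, List.mem_map]
    constructor
    · rintro (rfl | ⟨y, -, rfl⟩)
      · exact ho
      · exact (Finset.mem_erase.1 y.2).2
    · intro hx
      by_cases hxo : x = o
      · exact Or.inl hxo
      · exact Or.inr ⟨⟨x, Finset.mem_erase.2 ⟨hxo, hx⟩⟩, by simp [hl], rfl⟩
  have hget : ∀ i (hi : i < n), L.getD i o = L[i]'(hLlen ▸ hi) := fun i hi =>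
    List.getD_eq_getElem _ _ _
  refine ⟨fun i => L.getD i o, ?_, ?_, ?_⟩
  · ext x
    rw [← hLR, List.mem_toFinset, List.mem_iff_getElem, Finset.mem_image]
    constructor
    · rintro ⟨i, hi, rfl⟩
      rw [Finset.mem_range] at hi
      exact ⟨i, hLlen ▸ hi, (hget i hi).symm⟩
    · rintro ⟨i, hi, rfl⟩
      exact ⟨i, Finset.mem_range.2 (hLlen ▸ hi), hget i (hLlen ▸ hi)⟩
  · intro i hi j hj hij
    simp only [Set.mem_Iio] at hi hj
    simp only [hget i hi, hget j hj] at hij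
    exact (hLnd.getElem_inj_iff).1 hij
  · intro j k hj hjk hk
    obtain ⟨j, rfl⟩ : ∃ j', j = j' + 1 := ⟨j - 1, by omega⟩
    obtain ⟨k, rfl⟩ : ∃ k', k = k' + 1 := ⟨k - 1, by omega⟩
    change 0 < cr (L.getD 0 o) (L.getD (j + 1) o) (L.getD (k + 1) o)
    rw [hget _ (hjk.trans hk), hget _ hk, hget 0 hn]
    simp only [hL, List.getElem_cons_succ, List.getElem_cons_zero, List.getElem_map]
    have hk' : k < l.length := by omega
    rcases List.pairwise_iff_getElem.1 hpw j k (by omega) hk' (by omega) with h | h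
    · exact absurd ((hnd.getElem_inj_iff).1 h) (by omega)
    · exact h

/-! ### Sign formulas and their truth tables -/

/-- Boolean formulas in the orientations of the triples of a finite sequence of points. -/
inductive SignFormula : Type
  | verum : SignFormula
  | falsum : SignFormula
  | atom (i j k : ℕ) : SignFormula
  | neg (φ : SignFormula) : SignFormula
  | and (φ ψ : SignFormula) : SignFormula
  | or (φ ψ : SignFormula) : SignFormula
  | xor (φ ψ : SignFormula) : SignFormula

namespace SignFormula

/-- The truth value of a formula. -/
noncomputable def eval (e : ℕ → ℕ → ℕ → Bool) (φ : SignFormula) : Bool :=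
  SignFormula.rec true false (fun i j k => e i j k) (fun _ a => Bool.not a)
    (fun _ _ a b => Bool.and a b) (fun _ _ a b => Bool.or a b)
    (fun _ _ a b => bif a then Bool.not b else b) φ

/-- The truth table of a formula: bit `v` is its value under the assignment number `v`. -/
noncomputable def table (full : ℕ) (val : ℕ → ℕ → ℕ → ℕ) (φ : SignFormula) : ℕ :=
  SignFormula.rec full 0 (fun i j k => val i j k) (fun _ a => Nat.xor full a)
    (fun _ _ a b => Nat.land a b) (fun _ _ a b => Nat.lor a b) (fun _ _ a b => Nat.xor a b) φ

section

variable (e : ℕ → ℕ → ℕ → Bool) (φ ψ : SignFormula)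

@[simp] theorem eval_verum : verum.eval e = true := rfl
@[simp] theorem eval_falsum : falsum.eval e = false := rfl
@[simp] theorem eval_atom (i j k : ℕ) : (atom i j k).eval e = e i j k := rfl
@[simp] theorem eval_neg : (neg φ).eval e = !(φ.eval e) := rfl
@[simp] theorem eval_and : (and φ ψ).eval e = (φ.eval e && ψ.eval e) := rfl
@[simp] theorem eval_or : (or φ ψ).eval e = (φ.eval e || ψ.eval e) := rfl
@[simp] theorem eval_xor : (xor φ ψ).eval e = (φ.eval e ^^ ψ.eval e) := by
  change (bif φ.eval e then !(ψ.eval e) else ψ.eval e) = _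
  cases φ.eval e <;> simp

end

/-- The connectives act bitwise, so a single evaluation on natural numbers treats all assignments at
once. Negation is complementation in `full`, hence the condition on its bit `v`. -/
theorem testBit_table {full v : ℕ} (hv : full.testBit v = true) (val : ℕ → ℕ → ℕ → ℕ)
    (φ : SignFormula) :
    (φ.table full val).testBit v = φ.eval fun i j k => (val i j k).testBit v := by
  induction φ with
  | verum => exact hv
  | falsum => exact Nat.zero_testBit v
  | atom i j k => rfl
  | neg φ ih =>
    change (full ^^^ φ.table full val).testBit v = _
    rw [Nat.testBit_xor, hv, ih, eval_neg, Bool.true_xor]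
  | and φ ψ ih₁ ih₂ =>
    change (φ.table full val &&& ψ.table full val).testBit v = _
    rw [Nat.testBit_and, ih₁, ih₂, eval_and]
  | or φ ψ ih₁ ih₂ =>
    change (φ.table full val ||| ψ.table full val).testBit v = _
    rw [Nat.testBit_or, ih₁, ih₂, eval_or]
  | xor φ ψ ih₁ ih₂ =>
    change (φ.table full val ^^^ ψ.table full val).testBit v = _
    rw [Nat.testBit_xor, ih₁, ih₂, eval_xor]

/-- The point `k` lies on the left of the line from the point `i` to the point `j`. -/
def left (i j k : ℕ) : SignFormula :=
  -- Only atoms with increasing indices occur; other orders get the sign of the permutation, and a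
  -- repeated index gives area zero, that is `falsum`.
  bif Nat.blt i j then
    bif Nat.blt j k then atom i j k
    else bif Nat.blt k i then atom k i j
    else bif Nat.blt i k && Nat.blt k j then neg (atom i k j) else falsum
  else bif Nat.blt j i then
    bif Nat.blt i k then neg (atom j i k)
    else bif Nat.blt k j then neg (atom k j i)
    else bif Nat.blt j k && Nat.blt k i then atom j k i else falsum
  else falsum

def conj (l : List SignFormula) : SignFormula := l.foldr and verum

def disj (l : List SignFormula) : SignFormula := l.foldr or falsum

@[simp] theorem eval_conj_nil (e : ℕ → ℕ → ℕ → Bool) : (conj []).eval e = true := rfl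

@[simp] theorem eval_conj_cons (e : ℕ → ℕ → ℕ → Bool) (φ : SignFormula) (l : List SignFormula) :
    (conj (φ :: l)).eval e = (φ.eval e && (conj l).eval e) := rfl

@[simp] theorem eval_disj_nil (e : ℕ → ℕ → ℕ → Bool) : (disj []).eval e = false := rfl

@[simp] theorem eval_disj_cons (e : ℕ → ℕ → ℕ → Bool) (φ : SignFormula) (l : List SignFormula) :
    (disj (φ :: l)).eval e = (φ.eval e || (disj l).eval e) := rfl

theorem eval_conj (e : ℕ → ℕ → ℕ → Bool) (l : List SignFormula) :
    (conj l).eval e = true ↔ ∀ φ ∈ l, φ.eval e = true := by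
  induction l with
  | nil => simp
  | cons φ l ih => simp [ih]

theorem eval_disj (e : ℕ → ℕ → ℕ → Bool) (l : List SignFormula) :
    (disj l).eval e = true ↔ ∃ φ ∈ l, φ.eval e = true := by
  induction l with
  | nil => simp
  | cons φ l ih => simp [ih]

end SignFormula

open SignFormula

/-! ### Sign conditions satisfied by real point sets -/

/-- `e` gives the orientations of the triples of the first `n` points of `p`, which are in general
position. -/
def Represents (e : ℕ → ℕ → ℕ → Bool) (p : ℕ → Plane) (n : ℕ) : Prop :=
  ∀ i j k, i < j → j < k → k < n →
    cr (p i) (p j) (p k) ≠ 0 ∧ e i j k = decide (0 < cr (p i) (p j) (p k))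

namespace Represents

variable {e : ℕ → ℕ → ℕ → Bool} {p : ℕ → Plane} {n : ℕ}

theorem eval_left (h : Represents e p n) {i j k : ℕ} (hi : i < n) (hj : j < n) (hk : k < n) :
    (left i j k).eval e = decide (0 < cr (p i) (p j) (p k)) := by
  have flip : ∀ x y : ℝ, x ≠ 0 → y = -x → (!decide (0 < x)) = decide (0 < y) := by
    intro x y hx hy
    rw [← decide_not, decide_eq_decide]
    constructor
    · intro h; have := lt_of_le_of_ne (not_lt.1 h) hx; linarith
    · intro h; linarith
  have hb : ∀ a b, Nat.blt a b = decide (a < b) := fun a b => by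
    rw [Bool.eq_iff_iff, decide_eq_true_iff, Nat.blt_eq]
  simp only [left, hb]
  rcases lt_trichotomy i j with hij | rfl | hij
  · rcases lt_trichotomy j k with hjk | rfl | hjk
    · simp [hij, hjk, (h i j k hij hjk hk).2]
    · simp [hij, hij.not_gt, cr_self_right]
    · rcases lt_trichotomy k i with hki | rfl | hki
      · simp [hij, hjk.not_gt, hki, (h k i j hki hij hj).2, cr_rotate]
      · simp [hij, hij.not_gt, cr_self_outer]
      · simp only [hij, hjk.not_gt, hki.not_gt, hki, hjk, decide_true, decide_false, cond_true,
          cond_false, Bool.and_self, eval_neg, eval_atom, (h i k j hki hjk hj).2]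
        exact flip _ _ (h i k j hki hjk hj).1 (cr_swap_right _ _ _)
  · simp [cr_self_left]
  · rcases lt_trichotomy i k with hik | rfl | hik
    · simp only [hij, hij.not_gt, hik, decide_true, decide_false, cond_true,
          cond_false, eval_neg, eval_atom, (h j i k hij hik hk).2]
      exact flip _ _ (h j i k hij hik hk).1 (cr_swap _ _ _)
    · simp [hij, hij.not_gt, cr_self_outer]
    · rcases lt_trichotomy k j with hkj | rfl | hkj
      · simp only [hij, hij.not_gt, hik.not_gt, hkj, decide_true, decide_false, cond_true,
          cond_false, eval_neg, eval_atom, (h k j i hkj hij hi).2]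
        refine flip _ _ (h k j i hkj hij hi).1 ?_
        simp only [cr]; ring
      · simp [hij, hij.not_gt, cr_self_right]
      · simp [hij, hij.not_gt, hik.not_gt, hkj.not_gt, hkj, hik, (h j k i hkj hik hi).2, cr_rotate]

theorem xor_eq (h : Represents e p n) {i j k i' j' k' : ℕ} (hij : i < j) (hjk : j < k) (hk : k < n)
    (hij' : i' < j') (hjk' : j' < k') (hk' : k' < n) :
    (e i j k ^^ e i' j' k') = decide (cr (p i) (p j) (p k) * cr (p i') (p j') (p k') < 0) := by
  obtain ⟨h1, h2⟩ := h i j k hij hjk hk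
  obtain ⟨h3, h4⟩ := h i' j' k' hij' hjk' hk'
  rw [h2, h4]
  rcases h1.lt_or_gt with h1 | h1 <;> rcases h3.lt_or_gt with h3 | h3
  · simp [h1.not_gt, h3.not_gt, (mul_pos_of_neg_of_neg h1 h3).not_gt]
  · simp [h1.not_gt, h3, mul_neg_of_neg_of_pos h1 h3]
  · simp [h1, h3.not_gt, mul_neg_of_pos_of_neg h1 h3]
  · simp [h1, h3, (mul_pos h1 h3).not_gt]

end Represents

namespace SignFormula

/-- The numbers with the signs `φ₁φ₂`, `-χ₁χ₂` and `ψ₁ψ₂` do not all have the same sign. -/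
def plucker (φ₁ φ₂ χ₁ χ₂ ψ₁ ψ₂ : SignFormula) : SignFormula :=
  or (neg (xor (xor φ₁ φ₂) (xor χ₁ χ₂))) (xor (xor φ₁ φ₂) (xor ψ₁ ψ₂))

/-- The sign condition of the linear relation between the areas of the triangles on four points. -/
def affine (a b c d : ℕ) : SignFormula :=
  or (neg (xor (atom a b c) (atom a b d)))
    (or (neg (xor (atom a b c) (atom b c d))) (xor (atom a b c) (atom a c d)))

/-- The sign conditions of the three-term Grassmann–Plücker relations on five points. -/
def pluckers (a b c d e : ℕ) : SignFormula :=
  conj [plucker (atom a b c) (atom a d e) (atom a b d) (atom a c e) (atom a b e) (atom a c d),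
    plucker (atom a b c) (atom b d e) (atom a b d) (atom b c e) (atom a b e) (atom b c d),
    plucker (atom a b c) (atom c d e) (atom a c d) (atom b c e) (atom a c e) (atom b c d),
    plucker (atom a b d) (atom c d e) (atom a c d) (atom b d e) (atom a d e) (atom b c d),
    plucker (atom a b e) (atom c d e) (atom a c e) (atom b d e) (atom a d e) (atom b c e)]

/-- The truth value does not change both from `φ` to `ψ` and from `ψ` to `χ`. -/
def noTwoChanges (φ ψ χ : SignFormula) : SignFormula := or (neg (xor φ ψ)) (xor φ χ)

/-- The sign conditions on points `a`, `b`, `c`, `d` in angular order around another point. -/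
def monotone (a b c d : ℕ) : SignFormula :=
  conj [noTwoChanges (atom a b c) (atom a b d) (atom a c d),
    noTwoChanges (atom a b c) (atom a b d) (atom b c d),
    noTwoChanges (atom a b c) (atom a c d) (atom b c d),
    noTwoChanges (atom a b d) (atom a c d) (atom b c d)]

end SignFormula

namespace Represents

variable {e : ℕ → ℕ → ℕ → Bool} {p : ℕ → Plane} {n : ℕ}

theorem plucker_bool {r s t : ℝ} (h : r - s + t = 0) :
    (!(decide (r < 0) ^^ decide (s < 0)) || (decide (r < 0) ^^ decide (t < 0))) = true := by
  by_cases h1 : r < 0 <;> by_cases h2 : s < 0 <;> by_cases h3 : t < 0 <;> simp [h1, h2, h3] <;>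
    linarith

theorem eval_pluckers (h : Represents e p n) {a b c d f : ℕ} (hab : a < b) (hbc : b < c)
    (hcd : c < d) (hdf : d < f) (hf : f < n) : (pluckers a b c d f).eval e = true := by
  have hac := hab.trans hbc
  have hbd := hbc.trans hcd
  have hcf := hcd.trans hdf
  have had := hac.trans hcd
  have hbf := hbd.trans hdf
  have hd := hdf.trans hf
  have hc := hcd.trans hd
  simp only [pluckers, plucker, eval_conj_cons, eval_conj_nil, eval_or, eval_neg, eval_xor,
    eval_atom, Bool.and_true, Bool.and_eq_true]
  refine ⟨?_, ?_, ?_, ?_, ?_⟩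
  all_goals
    rw [h.xor_eq, h.xor_eq, h.xor_eq]
    · apply plucker_bool
      simp only [cr]; ring
  all_goals assumption

theorem eval_affine (h : Represents e p n) {a b c d : ℕ} (hab : a < b) (hbc : b < c)
    (hcd : c < d) (hd : d < n) : (affine a b c d).eval e = true := by
  have h1 := h a b c hab hbc (hcd.trans hd)
  have h2 := h a b d hab (hbc.trans hcd) hd
  have h3 := h a c d (hab.trans hbc) hcd hd
  have h4 := h b c d hbc hcd hd
  have key : cr (p a) (p b) (p c) - cr (p a) (p b) (p d) + cr (p a) (p c) (p d) -
      cr (p b) (p c) (p d) = 0 := by simp only [cr]; ring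
  simp only [affine, eval_or, eval_neg, eval_xor, eval_atom, h1.2, h2.2, h3.2, h4.2]
  rcases h1.1.lt_or_gt with g1 | g1 <;> rcases h2.1.lt_or_gt with g2 | g2 <;>
    rcases h3.1.lt_or_gt with g3 | g3 <;> rcases h4.1.lt_or_gt with g4 | g4 <;>
    simp [g1, g2, g3, g4, g1.not_gt, g2.not_gt, g3.not_gt, g4.not_gt] <;> linarith

theorem monotone_bool {r s t α β γ : ℝ} (hr : r ≠ 0) (hs : s ≠ 0) (ht : t ≠ 0) (hα : 0 < α)
    (hβ : 0 < β) (hγ : 0 < γ) (h : α * r - β * s + γ * t = 0) :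
    (!(decide (0 < r) ^^ decide (0 < s)) || (decide (0 < r) ^^ decide (0 < t))) = true := by
  rcases hr.lt_or_gt with h1 | h1 <;> rcases hs.lt_or_gt with h2 | h2 <;>
    rcases ht.lt_or_gt with h3 | h3 <;>
    simp [h1, h2, h3, h1.not_gt, h2.not_gt, h3.not_gt]
  · nlinarith [mul_pos hβ h2, mul_neg_of_pos_of_neg hα h1, mul_neg_of_pos_of_neg hγ h3]
  · nlinarith [mul_pos hα h1, mul_neg_of_pos_of_neg hβ h2, mul_pos hγ h3]

/-- Each condition is a Grassmann–Plücker relation on the points 0, `a`, `b`, `c`, `d` in which the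
factors containing 0 are positive: a relation α r - β s + γ t = 0 with positive weights forbids two
sign changes in r, s, t. -/
theorem eval_monotone (h : Represents e p n) {a b c d : ℕ} (ha : 0 < a) (hab : a < b) (hbc : b < c)
    (hcd : c < d) (hd : d < n)
    (h0 : ∀ j k, 0 < j → j < k → k < n → 0 < cr (p 0) (p j) (p k)) :
    (monotone a b c d).eval e = true := by
  have hac := hab.trans hbc
  have hbd := hbc.trans hcd
  have had := hac.trans hcd
  have hc := hcd.trans hd
  have hb := hbc.trans hc
  have hb0 := ha.trans hab
  have hc0 := hb0.trans hbc
  have h1 := h a b c hab hbc hc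
  have h2 := h a b d hab hbd hd
  have h3 := h a c d hac hcd hd
  have h4 := h b c d hbc hcd hd
  have k1 := h0 a b ha hab hb
  have k2 := h0 a c ha hac hc
  have k3 := h0 a d ha had hd
  have k4 := h0 b c hb0 hbc hc
  have k5 := h0 b d hb0 hbd hd
  have k6 := h0 c d hc0 hcd hd
  simp only [monotone, noTwoChanges, eval_conj_cons, eval_conj_nil, eval_or, eval_neg, eval_xor,
    eval_atom, Bool.and_true, Bool.and_eq_true, h1.2, h2.2, h3.2, h4.2]
  refine ⟨monotone_bool h1.1 h2.1 h3.1 k3 k2 k1 ?_, monotone_bool h1.1 h2.1 h4.1 k5 k4 k1 ?_,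
    monotone_bool h1.1 h3.1 h4.1 k6 k4 k2 ?_, monotone_bool h2.1 h3.1 h4.1 k6 k5 k3 ?_⟩ <;>
  · simp only [cr]; ring

end Represents

/-! ### Truth tables as natural numbers -/

/-- Evaluation of the argument before substitution, for evaluation in the kernel. -/
noncomputable def force {α : Type} (n : ℕ) (f : ℕ → α) : α :=
  Nat.rec (f 0) (fun k _ => f (Nat.succ k)) n

theorem force_eq {α : Type} (n : ℕ) (f : ℕ → α) : force n f = f n := by cases n <;> rfl

noncomputable def forceList : List ℕ → (List ℕ → Bool) → Bool
  | [], f => f []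
  | a :: l, f => force a fun b => forceList l fun t => f (b :: t)

theorem forceList_eq (l : List ℕ) (f : List ℕ → Bool) : forceList l f = f l := by
  induction l generalizing f with
  | nil => rfl
  | cons a l ih => rw [forceList, force_eq, ih]

noncomputable def allLt (n : ℕ) (f : ℕ → Bool) : Bool := Nat.rec true (fun k ih => f k && ih) n

theorem of_allLt {n : ℕ} {f : ℕ → Bool} (h : allLt n f = true) {k : ℕ} (hk : k < n) :
    f k = true := by
  induction n with
  | zero => omega
  | succ n ih =>
    have h' : (f n && allLt n f) = true := h
    rw [Bool.and_eq_true] at h'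
    rcases Nat.lt_succ_iff_lt_or_eq.1 hk with hk | rfl
    · exact ih h'.2 hk
    · exact h'.1

def bitOf (m c : ℕ) : Bool := Nat.beq (Nat.land (Nat.shiftRight m c) 1) 1

theorem bitOf_eq (m c : ℕ) : bitOf m c = m.testBit c := by
  change Nat.beq ((m >>> c) &&& 1) 1 = _
  rw [Nat.testBit, Nat.and_comm 1, Nat.and_one_is_mod]
  rcases Nat.mod_two_eq_zero_or_one (m >>> c) with h | h <;> rw [h] <;> rfl

def ones (w : ℕ) : ℕ := Nat.sub (Nat.shiftLeft 1 w) 1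

theorem ones_eq (w : ℕ) : ones w = 2 ^ w - 1 := by
  change 1 <<< w - 1 = _
  rw [Nat.one_shiftLeft]

theorem testBit_ones (w v : ℕ) : (ones w).testBit v = decide (v < w) := by
  rw [ones_eq, Nat.testBit_two_pow_sub_one]

/-- The truth table of variable `i` among `i + 1 + d` variables. -/
noncomputable def column (i d : ℕ) : ℕ :=
  -- The initial block has 2^i zeros in the low bits and 2^i ones above them; it is then doubled `d`
  -- times.
  Nat.rec (Nat.shiftLeft (ones (Nat.pow 2 i)) (Nat.pow 2 i))
    (fun k c => Nat.lor c (Nat.shiftLeft c (Nat.pow 2 (Nat.add i (Nat.succ k))))) d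

theorem column_zero (i : ℕ) : column i 0 = ones (2 ^ i) <<< 2 ^ i := rfl

theorem column_succ (i d : ℕ) :
    column i (d + 1) = column i d ||| column i d <<< 2 ^ (i + (d + 1)) := rfl

theorem column_lt (i d : ℕ) : column i d < 2 ^ 2 ^ (i + (d + 1)) := by
  have hshift : ∀ x m, x < 2 ^ 2 ^ m → x <<< 2 ^ m < 2 ^ 2 ^ (m + 1) := by
    intro x m hx
    rw [Nat.shiftLeft_eq, pow_succ 2 m, mul_two, pow_add]
    exact Nat.mul_lt_mul_of_pos_right hx (by positivity)
  induction d with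
  | zero =>
    rw [column_zero]
    apply hshift
    rw [ones_eq]
    have : 0 < 2 ^ 2 ^ i := by positivity
    omega
  | succ d ih =>
    rw [column_succ]
    apply Nat.or_lt_two_pow
    · exact ih.trans (Nat.pow_lt_pow_right (by norm_num)
        (Nat.pow_lt_pow_right (by norm_num) (by omega)))
    · exact hshift _ _ ih

theorem testBit_column {i d v : ℕ} (hv : v < 2 ^ (i + (d + 1))) :
    (column i d).testBit v = v.testBit i := by
  induction d generalizing v with
  | zero =>
    rw [zero_add] at hv
    rw [column_zero, Nat.testBit_shiftLeft, testBit_ones]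
    have hp : 2 ^ (i + 1) = 2 ^ i + 2 ^ i := by ring
    rcases lt_or_ge v (2 ^ i) with h | h
    · rw [Nat.testBit_lt_two_pow h]
      simp [h]
    · obtain ⟨w, rfl⟩ := Nat.exists_eq_add_of_le h
      have hw : w < 2 ^ i := by omega
      rw [Nat.testBit_two_pow_add_eq, Nat.testBit_lt_two_pow hw]
      simp [hw]
  | succ d ih =>
    rw [column_succ, Nat.testBit_or, Nat.testBit_shiftLeft]
    have hp : 2 ^ (i + (d + 1 + 1)) = 2 ^ (i + (d + 1)) + 2 ^ (i + (d + 1)) := by ring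
    rcases lt_or_ge v (2 ^ (i + (d + 1))) with h | h
    · rw [ih h]
      simp [h.not_ge]
    · obtain ⟨w, rfl⟩ := Nat.exists_eq_add_of_le h
      have hw : w < 2 ^ (i + (d + 1)) := by omega
      rw [Nat.testBit_lt_two_pow ((column_lt i d).trans_le (Nat.pow_le_pow_right (by norm_num) h)),
        Nat.add_sub_cancel_left, ih hw, Nat.testBit_two_pow_add_gt (by omega)]
      simp

theorem exists_testBit_eq (f : ℕ → Bool) (N : ℕ) : ∃ v < 2 ^ N, ∀ i < N, v.testBit i = f i :=
  ⟨Nat.ofBits fun i : Fin N => f i, Nat.ofBits_lt_two_pow _, fun i hi => by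
    rw [Nat.testBit_ofBits_lt _ _ hi]⟩

/-! ### Numbering of pairs and triples -/

/-- The number of the pair `i < j` in colexicographic order. -/
def pairRank (i j : ℕ) : ℕ := Nat.add i (Nat.div (Nat.mul j (Nat.sub j 1)) 2)

/-- The number of the triple `0 < i < j < k` in colexicographic order. -/
def tripleRank (i j k : ℕ) : ℕ :=
  Nat.add (pairRank (Nat.sub i 1) (Nat.sub j 1))
    (Nat.div (Nat.mul (Nat.sub k 1) (Nat.mul (Nat.sub k 2) (Nat.sub k 3))) 6)

def pairList (n : ℕ) : List (ℕ × ℕ) :=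
  (List.range n).flatMap fun j => (List.range j).map fun i => (i, j)

def tripleList (n : ℕ) : List (ℕ × ℕ × ℕ) :=
  (List.range n).flatMap fun k => (pairList k).flatMap fun q =>
    if q.1 = 0 then [] else [(q.1, q.2, k)]

theorem mem_pairList {n i j : ℕ} (hij : i < j) (hj : j < n) : (i, j) ∈ pairList n := by
  simp only [pairList, List.mem_flatMap, List.mem_map, List.mem_range]
  exact ⟨j, hj, i, hij, rfl⟩

theorem mem_tripleList {n i j k : ℕ} (hi : 0 < i) (hij : i < j) (hjk : j < k) (hk : k < n) :
    (i, j, k) ∈ tripleList n := by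
  simp only [tripleList, List.mem_flatMap, List.mem_range]
  exact ⟨k, hk, (i, j), mem_pairList hij hjk, by simp [hi.ne']⟩

/-- `pairRank` numbers the pairs below `n` by the numbers below `N`. -/
def PairNumbering (n N : ℕ) : Prop :=
  ∀ q ∈ pairList n, pairRank q.1 q.2 < N ∧ (pairList n).getD (pairRank q.1 q.2) (0, 0) = q

/-- `tripleRank` numbers the triples of positive numbers below `n` by the numbers below `N`. -/
def TripleNumbering (n N : ℕ) : Prop :=
  ∀ q ∈ tripleList n, tripleRank q.1 q.2.1 q.2.2 < N ∧
    (tripleList n).getD (tripleRank q.1 q.2.1 q.2.2) (0, 0, 0) = q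

instance (n N : ℕ) : Decidable (PairNumbering n N) := by unfold PairNumbering; infer_instance

instance (n N : ℕ) : Decidable (TripleNumbering n N) := by unfold TripleNumbering; infer_instance

/-- The list inverts the rank, so values prescribed at different pairs never compete for a bit. -/
theorem PairNumbering.exists_assignment {n N : ℕ} (h : PairNumbering n N) (f : ℕ → ℕ → Bool) :
    ∃ v < 2 ^ N, ∀ i j, i < j → j < n → v.testBit (pairRank i j) = f i j := by
  obtain ⟨v, hv, hf⟩ := exists_testBit_eq
    (fun r => f ((pairList n).getD r (0, 0)).1 ((pairList n).getD r (0, 0)).2) N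
  refine ⟨v, hv, fun i j hij hj => ?_⟩
  obtain ⟨h1, h2⟩ := h _ (mem_pairList hij hj)
  rw [hf _ h1]
  simp only [h2]

theorem TripleNumbering.exists_assignment {n N : ℕ} (h : TripleNumbering n N)
    (f : ℕ → ℕ → ℕ → Bool) :
    ∃ v < 2 ^ N, ∀ i j k, 0 < i → i < j → j < k → k < n → v.testBit (tripleRank i j k) = f i j k := by
  obtain ⟨v, hv, hf⟩ := exists_testBit_eq
    (fun r => f ((tripleList n).getD r (0, 0, 0)).1 ((tripleList n).getD r (0, 0, 0)).2.1
      ((tripleList n).getD r (0, 0, 0)).2.2) N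
  refine ⟨v, hv, fun i j k hi hij hjk hk => ?_⟩
  obtain ⟨h1, h2⟩ := h _ (mem_tripleList hi hij hjk hk)
  rw [hf _ h1]
  simp only [h2]

/-- There are C(n,2) pairs, and C(n-1,3) triples since those containing point 0 are left out. -/
theorem pairNumbering_four : PairNumbering 4 6 := by decide +kernel
theorem pairNumbering_five : PairNumbering 5 10 := by decide +kernel
theorem pairNumbering_six : PairNumbering 6 15 := by decide +kernel
theorem tripleNumbering_four : TripleNumbering 4 1 := by decide +kernel
theorem tripleNumbering_five : TripleNumbering 5 4 := by decide +kernel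
theorem tripleNumbering_six : TripleNumbering 6 10 := by decide +kernel
theorem tripleNumbering_seven : TripleNumbering 7 20 := by decide +kernel

namespace SignFormula

def inTriangle (a b c x : ℕ) : SignFormula :=
  or (and (left a b x) (and (left b c x) (left c a x)))
    (and (left b a x) (and (left c b x) (left a c x)))

def inBowtie (a b c d x : ℕ) : SignFormula :=
  or (and (left a b x) (and (left c a x) (left b d x)))
    (and (left c d x) (and (left a c x) (left d b x)))

def convexQuad (a b c d : ℕ) : SignFormula :=
  and (left a b c) (and (left b c d) (and (left c d a) (left d a b)))

end SignFormula

namespace Represents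

variable {e : ℕ → ℕ → ℕ → Bool} {p : ℕ → Plane} {n : ℕ}

theorem eval_inTriangle (h : Represents e p n) {a b c x : ℕ} (ha : a < n) (hb : b < n) (hc : c < n)
    (hx : x < n) :
    (inTriangle a b c x).eval e = true ↔ InTriangle (p a) (p b) (p c) (p x) := by
  simp only [inTriangle, eval_or, eval_and, h.eval_left, ha, hb, hc, hx, Bool.or_eq_true,
    Bool.and_eq_true, decide_eq_true_eq, InTriangle]

theorem eval_inBowtie (h : Represents e p n) {a b c d x : ℕ} (ha : a < n) (hb : b < n) (hc : c < n)
    (hd : d < n) (hx : x < n) :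
    (inBowtie a b c d x).eval e = true ↔ InBowtie (p a) (p b) (p c) (p d) (p x) := by
  simp only [inBowtie, eval_or, eval_and, h.eval_left, ha, hb, hc, hd, hx, Bool.or_eq_true,
    Bool.and_eq_true, decide_eq_true_eq, InBowtie]

theorem eval_convexQuad (h : Represents e p n) {a b c d : ℕ} (ha : a < n) (hb : b < n) (hc : c < n)
    (hd : d < n) :
    (convexQuad a b c d).eval e = true ↔ ConvexQuad (p a) (p b) (p c) (p d) := by
  simp only [convexQuad, eval_and, h.eval_left, ha, hb, hc, hd, Bool.and_eq_true,
    decide_eq_true_eq, ConvexQuad]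

end Represents

/-! ### Structures and sign axioms of a red configuration -/

/-- A bowtie on the counterclockwise convex quadrilateral `a b c d`, or a pant on the triangle
`b c d` with the interior point `a`. -/
structure Shape where
  isBowtie : Bool
  a : ℕ
  b : ℕ
  c : ℕ
  d : ℕ

namespace Shape

/-- The formula for a point in the interior of a shape. -/
def hit (s : Shape) (x : ℕ) : SignFormula :=
  bif s.isBowtie then inBowtie s.a s.b s.c s.d x
  else or (inTriangle s.a s.b s.c x) (inTriangle s.a s.b s.d x)

def bounded (n : ℕ) (s : Shape) : Bool :=
  Nat.blt s.a n && (Nat.blt s.b n && (Nat.blt s.c n && Nat.blt s.d n))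

/-- The formula for a shape to exist and not to contain further points among the first `n`. -/
def valid (n : ℕ) (s : Shape) : SignFormula :=
  and (bif s.isBowtie then convexQuad s.a s.b s.c s.d else inTriangle s.b s.c s.d s.a)
    (conj ((List.range n).map fun x => neg (s.hit x)))

def Hit (s : Shape) (p : ℕ → Plane) (x : Plane) : Prop :=
  if s.isBowtie then InBowtie (p s.a) (p s.b) (p s.c) (p s.d) x
  else InTriangle (p s.a) (p s.b) (p s.c) x ∨ InTriangle (p s.a) (p s.b) (p s.d) x

theorem bounded_iff {n : ℕ} {s : Shape} :
    s.bounded n = true ↔ s.a < n ∧ s.b < n ∧ s.c < n ∧ s.d < n := by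
  simp only [bounded, Bool.and_eq_true, Nat.blt_eq]

theorem eval_hit {e : ℕ → ℕ → ℕ → Bool} {p : ℕ → Plane} {n N : ℕ} (h : Represents e p N)
    (hnN : n ≤ N) {s : Shape} (hs : s.bounded n = true) {x : ℕ} (hx : x < N) :
    (s.hit x).eval e = true ↔ s.Hit p (p x) := by
  obtain ⟨h1, h2, h3, h4⟩ := bounded_iff.1 hs
  have h1 := h1.trans_le hnN
  have h2 := h2.trans_le hnN
  have h3 := h3.trans_le hnN
  have h4 := h4.trans_le hnN
  unfold hit Hit
  cases s.isBowtie
  · simp only [cond_false, eval_or, Bool.or_eq_true, h.eval_inTriangle h1 h2 h3 hx,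
      h.eval_inTriangle h1 h2 h4 hx, Bool.false_eq_true, if_false]
  · simp only [cond_true, h.eval_inBowtie h1 h2 h3 h4 hx, if_true]

theorem exists_hit {e : ℕ → ℕ → ℕ → Bool} {p : ℕ → Plane} {n : ℕ} (h : Represents e p n)
    {s : Shape} (hs : s.bounded n = true) (hv : (s.valid n).eval e = true) {B : Finset Plane}
    (hB : HitsAll B ((Finset.range n).image p)) : ∃ x ∈ B, s.Hit p x := by
  obtain ⟨h1, h2, h3, h4⟩ := bounded_iff.1 hs
  have hmem : ∀ i < n, p i ∈ (Finset.range n).image p := fun i hi =>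
    Finset.mem_image_of_mem p (Finset.mem_range.2 hi)
  simp only [valid, eval_and, Bool.and_eq_true, eval_conj, List.forall_mem_map, List.mem_range,
    eval_neg, Bool.not_eq_true'] at hv
  have hR : ∀ r ∈ (Finset.range n).image p, ¬ s.Hit p r := by
    intro r hr
    obtain ⟨i, hi, rfl⟩ := Finset.mem_image.1 hr
    have hi := Finset.mem_range.1 hi
    rw [← eval_hit h le_rfl hs hi, hv.2 i hi]
    simp
  have hv1 := hv.1
  unfold Hit at hR ⊢
  cases hb : s.isBowtie
  · simp only [hb, cond_false, h.eval_inTriangle h2 h3 h4 h1, Bool.false_eq_true,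
      if_false] at hv1 hR ⊢
    exact hB.2 _ (hmem _ h1) _ (hmem _ h2) _ (hmem _ h3) _ (hmem _ h4) hv1 hR
  · simp only [hb, cond_true, h.eval_convexQuad h1 h2 h3 h4, if_true] at hv1 hR ⊢
    exact hB.1 _ (hmem _ h1) _ (hmem _ h2) _ (hmem _ h3) _ (hmem _ h4) hv1 hR

end Shape

def quads (n : ℕ) : List (ℕ × ℕ × ℕ × ℕ) :=
  (List.range n).flatMap fun l => (List.range l).flatMap fun k => (List.range k).flatMap fun j =>
    (List.range j).map fun i => (i, j, k, l)

theorem lt_of_mem_quads {n i j k l : ℕ} (h : (i, j, k, l) ∈ quads n) :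
    i < j ∧ j < k ∧ k < l ∧ l < n := by
  simp only [quads, List.mem_flatMap, List.mem_map, List.mem_range, Prod.mk.injEq] at h
  omega

/-- The indices are in cyclic order, counterclockwise if `b` holds and reversed otherwise. The two
bowties differ in which pair of opposite sides of the quadrilateral they keep. -/
def bowtiesOn (b : Bool) (i j k l : ℕ) : List Shape :=
  bif b then [⟨true, i, j, k, l⟩, ⟨true, j, k, l, i⟩] else [⟨true, l, k, j, i⟩, ⟨true, i, l, k, j⟩]

/-- The point `d` divides the triangle into three triangles, and a pant is the union of two of them;
the second point is the outer vertex that these share. -/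
def pantsOn (d i j k : ℕ) : List Shape :=
  [⟨false, d, i, j, k⟩, ⟨false, d, j, i, k⟩, ⟨false, d, k, i, j⟩]

/-- The bowties or pants on four points. -/
def shapesOn (e : ℕ → ℕ → ℕ → Bool) (i j k l : ℕ) : List Shape :=
  bif xor (e i j k) (e i j l) then
    bif xor (e i j k) (e j k l) then pantsOn j i k l
    else bif xor (e i j k) (e i k l) then bowtiesOn (e i j k) i l j k else pantsOn i j k l
  else bif xor (e i j k) (e j k l) then
    bif xor (e i j k) (e i k l) then bowtiesOn (e i j k) i j l k else pantsOn k i j l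
  else bif xor (e i j k) (e i k l) then pantsOn l i j k else bowtiesOn (e i j k) i j k l

/-- The structures on the first `n` points. -/
noncomputable def shapes (e : ℕ → ℕ → ℕ → Bool) (n : ℕ) : List Shape :=
  -- The filter verifies every candidate, so `shapesOn` needs no correctness proof; a missing
  -- structure could only make the covering search harder to refute.
  ((quads n).flatMap fun q => shapesOn e q.1 q.2.1 q.2.2.1 q.2.2.2).filter fun s =>
    s.bounded n && (s.valid n).eval e

/-- The orientations of the first points, of which the others follow in angular order around point
`0`, from the assignment number `v`. -/
def redSign (v i j k : ℕ) : Bool := Nat.beq i 0 || bitOf v (tripleRank i j k)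

/-- The truth tables for the position of a further point `n`, where `N` is the number of pairs of
points below `n`. -/
noncomputable def blueTable (n v N full i j k : ℕ) : ℕ :=
  -- Triples containing the new point are variables, the others constants. The second argument of
  -- `column` extends the table to all `N` variables.
  bif Nat.beq k n then column (pairRank i j) (Nat.sub (Nat.sub N 1) (pairRank i j))
  else bif redSign v i j k then full else 0

/-- Necessary conditions suffice here and in `blueAxioms`: sign patterns that no point set realizes
only add cases to be checked. -/
def redAxioms (n : ℕ) : SignFormula :=
  conj ((quads n).map fun q =>
    bif Nat.beq q.1 0 then verum else monotone q.1 q.2.1 q.2.2.1 q.2.2.2)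

def blueAxioms (n : ℕ) : SignFormula :=
  conj ((quads n).map fun q =>
    conj [pluckers q.1 q.2.1 q.2.2.1 q.2.2.2 n, affine q.1 q.2.1 q.2.2.1 n,
      affine q.1 q.2.1 q.2.2.2 n, affine q.1 q.2.2.1 q.2.2.2 n, affine q.2.1 q.2.2.1 q.2.2.2 n])

theorem beq_zero_of_ne {n : ℕ} (h : n ≠ 0) : Nat.beq n 0 = false := by
  cases n
  · exact absurd rfl h
  · rfl

theorem Represents.eval_redAxioms {e : ℕ → ℕ → ℕ → Bool} {p : ℕ → Plane} {n : ℕ}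
    (h : Represents e p n) (h0 : ∀ j k, 0 < j → j < k → k < n → 0 < cr (p 0) (p j) (p k)) :
    (redAxioms n).eval e = true := by
  rw [redAxioms, eval_conj, List.forall_mem_map]
  rintro ⟨i, j, k, l⟩ hq
  obtain ⟨hij, hjk, hkl, hl⟩ := lt_of_mem_quads hq
  rcases Nat.eq_zero_or_pos i with rfl | hi
  · rfl
  · simp only [beq_zero_of_ne hi.ne', cond_false]
    exact h.eval_monotone hi hij hjk hkl hl h0

theorem Represents.eval_blueAxioms {e : ℕ → ℕ → ℕ → Bool} {p : ℕ → Plane} {n : ℕ}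
    (h : Represents e p (n + 1)) : (blueAxioms n).eval e = true := by
  rw [blueAxioms, eval_conj, List.forall_mem_map]
  rintro ⟨i, j, k, l⟩ hq
  obtain ⟨hij, hjk, hkl, hl⟩ := lt_of_mem_quads hq
  have hn := Nat.lt_succ_self n
  have hk := hkl.trans hl
  simp only [eval_conj_cons, eval_conj_nil, h.eval_pluckers hij hjk hkl hl hn,
    h.eval_affine hij hjk hk hn, h.eval_affine hij (hjk.trans hkl) hl hn,
    h.eval_affine (hij.trans hjk) hkl hl hn, h.eval_affine hjk hkl hl hn, Bool.and_self]

/-! ### Realizable hit sets and the covering search -/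

/-- The possible sets of elements of a list of truth tables that contain a common point of `s`. -/
noncomputable def hitSets (l : List ℕ) : ℕ → ℕ → List ℕ → List ℕ :=
  List.rec (fun s m acc => bif Nat.beq s 0 then acc else m :: acc)
    -- Splitting `s` by each table in turn and dropping empty parts keeps the list to hit patterns
    -- that occur, instead of all subsets.
    (fun h _ ih s m acc => bif Nat.beq s 0 then acc else
      ih (Nat.land s h) (Nat.succ (Nat.mul 2 m))
        (ih (Nat.xor s (Nat.land s h)) (Nat.mul 2 m) acc)) l

theorem hitSets_nil (s m : ℕ) (acc : List ℕ) :
    hitSets [] s m acc = bif Nat.beq s 0 then acc else m :: acc := rfl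

theorem hitSets_cons (h : ℕ) (l : List ℕ) (s m : ℕ) (acc : List ℕ) :
    hitSets (h :: l) s m acc = bif Nat.beq s 0 then acc else
      hitSets l (s &&& h) (2 * m + 1) (hitSets l (s ^^^ (s &&& h)) (2 * m) acc) := rfl

/-- The set of elements of a list of truth tables that contain `v`, appended to `m`. -/
def hitSet (v : ℕ) : List ℕ → ℕ → ℕ
  | [], m => m
  | h :: l, m => hitSet v l (Nat.bit (h.testBit v) m)

theorem subset_hitSets (l : List ℕ) (s m : ℕ) (acc : List ℕ) : acc ⊆ hitSets l s m acc := by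
  induction l generalizing s m acc with
  | nil =>
    rw [hitSets_nil]
    cases Nat.beq s 0
    · exact List.subset_cons_self m acc
    · exact List.Subset.refl _
  | cons h l ih =>
    rw [hitSets_cons]
    cases Nat.beq s 0
    · exact List.Subset.trans (ih _ _ _) (ih _ _ _)
    · exact List.Subset.refl _

theorem beq_zero_of_testBit {s v : ℕ} (h : s.testBit v = true) : Nat.beq s 0 = false := by
  apply beq_zero_of_ne
  rintro rfl
  simp at h

theorem hitSet_mem_hitSets {v : ℕ} (l : List ℕ) (s m : ℕ) (acc : List ℕ)
    (hs : s.testBit v = true) : hitSet v l m ∈ hitSets l s m acc := by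
  induction l generalizing s m acc with
  | nil =>
    rw [hitSets_nil, beq_zero_of_testBit hs]
    exact List.mem_cons_self
  | cons h l ih =>
    rw [hitSets_cons, beq_zero_of_testBit hs, cond_false, hitSet]
    cases hv : h.testBit v
    · apply subset_hitSets
      apply ih
      rw [Nat.testBit_xor, Nat.testBit_and, hs, hv]
      rfl
    · apply ih
      rw [Nat.testBit_and, hs, hv]
      rfl

theorem testBit_hitSet_add (v : ℕ) (l : List ℕ) (m t : ℕ) :
    (hitSet v l m).testBit (l.length + t) = m.testBit t := by
  induction l generalizing m t with
  | nil => simp [hitSet]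
  | cons h l ih =>
    rw [hitSet, List.length_cons, show l.length + 1 + t = l.length + (t + 1) by omega, ih,
      Nat.testBit_bit_succ]

theorem exists_testBit_hitSet {l : List ℕ} {t : ℕ} (ht : t < l.length) :
    ∃ h ∈ l, ∀ v m, (hitSet v l m).testBit t = h.testBit v := by
  induction l with
  | nil => simp at ht
  | cons h l ih =>
    rw [List.length_cons, Nat.lt_succ_iff_lt_or_eq] at ht
    rcases ht with ht | rfl
    · obtain ⟨h', hm, hh⟩ := ih ht
      exact ⟨h', List.mem_cons_of_mem _ hm, fun v m => hh v _⟩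
    -- The head of the list is pushed first and ends up as the highest bit.
    · refine ⟨h, List.mem_cons_self, fun v m => ?_⟩
      have := testBit_hitSet_add v l (Nat.bit (h.testBit v) m) 0
      rw [add_zero, Nat.testBit_bit_zero] at this
      exact this

/-- No `k` of the given sets cover the set `rem`. -/
noncomputable def notCovered (sets : List ℕ) (k : ℕ) : ℕ → Bool :=
  Nat.rec (fun rem => not (Nat.beq rem 0)) (fun _ ih rem =>
    -- Some set of a cover must contain the largest uncovered element, so it is enough to branch
    -- over the sets that do.
    not (Nat.beq rem 0) && force (Nat.log2 rem) fun t => sets.all fun c => not (bitOf c t) ||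
      force (Nat.xor rem (Nat.land rem c)) ih) k

theorem notCovered_zero (sets : List ℕ) (rem : ℕ) :
    notCovered sets 0 rem = !(Nat.beq rem 0) := rfl

theorem notCovered_succ (sets : List ℕ) (k rem : ℕ) :
    notCovered sets (k + 1) rem = (!(Nat.beq rem 0) && sets.all fun c =>
      !(c.testBit rem.log2) || notCovered sets k (rem ^^^ (rem &&& c))) := by
  change (!(Nat.beq rem 0) && force (Nat.log2 rem) fun t => sets.all fun c => !(bitOf c t) ||
    force (Nat.xor rem (Nat.land rem c)) (notCovered sets k)) = _
  simp only [force_eq, bitOf_eq]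
  rfl

/-- If no member of `C` contains the largest element of `rem`, that element is the witness;
otherwise a member containing it is removed from `C`, and its elements from `rem`. -/
theorem exists_not_testBit {sets : List ℕ} {k rem : ℕ} (h : notCovered sets k rem = true)
    {C : Finset ℕ} (hC : C.card ≤ k) (hsub : ∀ c ∈ C, c ∈ sets) :
    ∃ t, rem.testBit t = true ∧ ∀ c ∈ C, c.testBit t = false := by
  have hlog : ∀ {rem}, (!(Nat.beq rem 0)) = true → rem.testBit rem.log2 = true := by
    intro rem hrem
    apply Nat.testBit_log2
    rintro rfl
    simp at hrem
  induction k generalizing rem C with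
  | zero =>
    rw [notCovered_zero] at h
    obtain rfl : C = ∅ := Finset.card_eq_zero.1 (by omega)
    exact ⟨_, hlog h, by simp⟩
  | succ k ih =>
    rw [notCovered_succ, Bool.and_eq_true, List.all_eq_true] at h
    by_cases hc : ∃ c ∈ C, c.testBit rem.log2 = true
    · obtain ⟨c, hcC, hct⟩ := hc
      have h1 := h.2 c (hsub c hcC)
      rw [hct, Bool.not_true, Bool.false_or] at h1
      obtain ⟨t, ht, htC⟩ := ih h1 (C := C.erase c)
        (by rw [Finset.card_erase_of_mem hcC]; omega)
        fun c' hc' => hsub c' (Finset.mem_of_mem_erase hc')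
      rw [Nat.testBit_xor, Nat.testBit_and] at ht
      have ht1 : rem.testBit t = true ∧ c.testBit t = false := by
        revert ht
        cases rem.testBit t <;> cases c.testBit t <;> simp
      refine ⟨t, ht1.1, fun c' hc' => ?_⟩
      by_cases hcc : c' = c
      · exact hcc ▸ ht1.2
      · exact htC c' (Finset.mem_erase.2 ⟨hcc, hc'⟩)
    · push Not at hc
      exact ⟨_, hlog h.1, fun c hcC => by simpa using hc c hcC⟩

/-! ### Soundness of the check -/

/-- If the points with the orientations `v` are subject to the relations between orientations and
not to `φ`, then no `k` further points hit all structures. -/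
noncomputable def check (n N k : ℕ) (φ : SignFormula) (v : ℕ) : Bool :=
  -- Patterns that violate the axioms or satisfy the exceptional case `φ` are dismissed before any
  -- table is built.
  not ((and (redAxioms n) (neg φ)).eval (redSign v)) ||
    (fun hs => forceList
      (hitSets hs ((blueAxioms n).table (ones (Nat.pow 2 N)) (blueTable n v N (ones (Nat.pow 2 N))))
        0 []) fun sets => notCovered sets k (ones hs.length))
      ((shapes (redSign v) n).map fun s =>
        (s.hit n).table (ones (Nat.pow 2 N)) (blueTable n v N (ones (Nat.pow 2 N))))

theorem redSign_represents {p : ℕ → Plane} {n v : ℕ}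
    (hne : ∀ i j k, i < j → j < k → k < n → cr (p i) (p j) (p k) ≠ 0)
    (h0 : ∀ j k, 0 < j → j < k → k < n → 0 < cr (p 0) (p j) (p k))
    (hv : ∀ i j k, 0 < i → i < j → j < k → k < n →
      v.testBit (tripleRank i j k) = decide (0 < cr (p i) (p j) (p k))) :
    Represents (redSign v) p n := by
  intro i j k hij hjk hk
  refine ⟨hne i j k hij hjk hk, ?_⟩
  rcases Nat.eq_zero_or_pos i with rfl | hi
  · simp [redSign, h0 j k hij hjk hk]
  · rw [redSign, beq_zero_of_ne hi.ne', Bool.false_or, bitOf_eq, hv i j k hi hij hjk hk]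

theorem testBit_blueTable {n v N w i j k : ℕ} (hw : w < 2 ^ N)
    (hr : k = n → pairRank i j < N) :
    (blueTable n v N (ones (Nat.pow 2 N)) i j k).testBit w =
      if k = n then w.testBit (pairRank i j) else redSign v i j k := by
  rw [blueTable]
  by_cases hk : k = n
  · have hb : Nat.beq k n = true := by subst hk; exact Nat.beq_refl k
    rw [hb, cond_true, if_pos hk]
    apply testBit_column
    have := hr hk
    change w < 2 ^ (pairRank i j + (N - 1 - pairRank i j + 1))
    rwa [show pairRank i j + (N - 1 - pairRank i j + 1) = N by omega]
  · have hb : Nat.beq k n = false := by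
      rw [Bool.eq_false_iff]; exact fun h => hk (Nat.eq_of_beq_eq_true h)
    rw [hb, cond_false, if_neg hk]
    cases redSign v i j k
    · exact Nat.zero_testBit w
    · rw [cond_true, testBit_ones]
      exact decide_eq_true hw

/-- The sequence `p` with the point `x` at position `n`. -/
def withPoint (p : ℕ → Plane) (n : ℕ) (x : Plane) (i : ℕ) : Plane := if i = n then x else p i

theorem withPoint_self (p : ℕ → Plane) (n : ℕ) (x : Plane) : withPoint p n x n = x := if_pos rfl

theorem withPoint_of_lt (p : ℕ → Plane) {n i : ℕ} (x : Plane) (hi : i < n) :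
    withPoint p n x i = p i := if_neg hi.ne

theorem exists_blueTable_represents {p : ℕ → Plane} {n N v : ℕ} (hN : PairNumbering n N)
    (h : Represents (redSign v) p n) {x : Plane}
    (hx : ∀ i j, i < j → j < n → cr (p i) (p j) x ≠ 0) :
    ∃ w < 2 ^ N, Represents
      (fun i j k => (blueTable n v N (ones (Nat.pow 2 N)) i j k).testBit w)
      (withPoint p n x) (n + 1) := by
  obtain ⟨w, hw, hbit⟩ := hN.exists_assignment fun i j => decide (0 < cr (p i) (p j) x)
  refine ⟨w, hw, fun i j k hij hjk hk => ?_⟩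
  have hj : j < n := by omega
  have hi : i < n := by omega
  have hr : k = n → pairRank i j < N := fun _ => (hN _ (mem_pairList hij hj)).1
  beta_reduce
  rw [testBit_blueTable hw hr, withPoint_of_lt p x hi, withPoint_of_lt p x hj]
  rcases (Nat.lt_succ_iff_lt_or_eq.1 hk) with hk | rfl
  · rw [withPoint_of_lt p x hk, if_neg hk.ne]
    exact h i j k hij hjk hk
  · rw [withPoint_self, if_pos rfl]
    exact ⟨hx i j hij hj, hbit i j hij hj⟩

/-- Each blue point is compared with the red points alone and contributes one listed hit set. At
most `k` of these leave some structure unhit, contrary to `HitsAll`; relations between blue points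
play no role. -/
theorem lt_card_of_check {n N k v : ℕ} {φ : SignFormula} (hcheck : check n N k φ v = true)
    (hN : PairNumbering n N) {p : ℕ → Plane} (hv : Represents (redSign v) p n)
    (h0 : ∀ j k, 0 < j → j < k → k < n → 0 < cr (p 0) (p j) (p k))
    (hφ : φ.eval (redSign v) = false) {B : Finset Plane}
    (hB : ∀ x ∈ B, ∀ i j, i < j → j < n → cr (p i) (p j) x ≠ 0)
    (hits : HitsAll B ((Finset.range n).image p)) : k < B.card := by
  classical
  by_contra hk
  have hred := hv.eval_redAxioms h0
  rw [check, eval_and, hred, eval_neg, hφ] at hcheck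
  simp only [Bool.not_false, Bool.and_self, Bool.not_true, Bool.false_or, forceList_eq] at hcheck
  set full := ones (Nat.pow 2 N) with hfull
  set tab := blueTable n v N full with htab
  set hs := (shapes (redSign v) n).map fun s => (s.hit n).table full tab with hhs
  choose! w hw hrep using fun x hx => exists_blueTable_represents hN hv (hB x hx)
  have hbit : ∀ x ∈ B, full.testBit (w x) = true := fun x hx => by
    rw [hfull, testBit_ones]; exact decide_eq_true (hw x hx)
  obtain ⟨t, ht, hC⟩ := exists_not_testBit hcheck (C := B.image fun x => hitSet (w x) hs 0)
    (Finset.card_image_le.trans (not_lt.1 hk)) (by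
      intro c hc
      obtain ⟨x, hx, rfl⟩ := Finset.mem_image.1 hc
      apply hitSet_mem_hitSets
      rw [testBit_table (hbit x hx)]
      exact (hrep x hx).eval_blueAxioms)
  rw [testBit_ones, decide_eq_true_iff] at ht
  obtain ⟨h, hmem, hh⟩ := exists_testBit_hitSet ht
  rw [hhs, List.mem_map] at hmem
  obtain ⟨s, hs', rfl⟩ := hmem
  rw [shapes, List.mem_filter, Bool.and_eq_true] at hs'
  obtain ⟨x, hx, hit⟩ := s.exists_hit hv hs'.2.1 hs'.2.2 hits
  have h1 := hC _ (Finset.mem_image_of_mem _ hx)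
  rw [hh, testBit_table (hbit x hx)] at h1
  have h2 : (s.hit n).eval (fun i j k => (tab i j k).testBit (w x)) = true := by
    rw [Shape.eval_hit (hrep x hx) (Nat.le_succ n) hs'.2.1 (Nat.lt_succ_self n), withPoint_self]
    obtain ⟨b1, b2, b3, b4⟩ := Shape.bounded_iff.1 hs'.2.1
    unfold Shape.Hit at hit ⊢
    rwa [withPoint_of_lt p x b1, withPoint_of_lt p x b2, withPoint_of_lt p x b3,
      withPoint_of_lt p x b4]
  rw [h2] at h1
  exact Bool.noConfusion h1

/-! ### Lower bounds for four, five and six points -/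

/-- At least `k` points are necessary to hit all structures of `R`. -/
def Needs (R : Finset Plane) (k : ℕ) : Prop :=
  ∀ B : Finset Plane, Disjoint R B → GeneralPosition ((R : Set Plane) ∪ (B : Set Plane)) →
    HitsAll B R → k ≤ B.card

theorem Needs.requiresBlockers {R : Finset Plane} {k : ℕ} (h : Needs R k) :
    RequiresBlockers {pant, bowtie} R k :=
  fun B hRB hGP hB => h B hRB hGP (hB.hitsAll hRB hGP)

theorem GeneralPosition.mono {P Q : Set Plane} (h : GeneralPosition Q) (hPQ : P ⊆ Q) :
    GeneralPosition P :=
  fun a ha b hb c hc => h a (hPQ ha) b (hPQ hb) c (hPQ hc)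

/-- Points in general position have an assignment number. -/
theorem exists_assignment {R : Finset Plane} (hGP : GeneralPosition (R : Set Plane)) {n M : ℕ}
    (hn : 0 < n) (hR : R.card = n) (hM : TripleNumbering n M) :
    ∃ p : ℕ → Plane, ∃ v < 2 ^ M, (Finset.range n).image p = R ∧ Set.InjOn p (Set.Iio n) ∧
      (∀ j k, 0 < j → j < k → k < n → 0 < cr (p 0) (p j) (p k)) ∧
      (∀ i j k, 0 < i → i < j → j < k → k < n →
        v.testBit (tripleRank i j k) = decide (0 < cr (p i) (p j) (p k))) ∧
      ∀ i j k, i < j → j < k → k < n → cr (p i) (p j) (p k) ≠ 0 := by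
  obtain ⟨p, hp, hinj, h0⟩ := exists_labelling hGP hn hR
  obtain ⟨v, hv, hbit⟩ := hM.exists_assignment fun i j k => decide (0 < cr (p i) (p j) (p k))
  refine ⟨p, v, hv, hp, hinj, h0, hbit, fun i j k hij hjk hk => ?_⟩
  have hmem : ∀ i < n, p i ∈ (R : Set Plane) := fun i hi => by
    rw [← hp]; exact Finset.mem_coe.2 (Finset.mem_image_of_mem p (Finset.mem_range.2 hi))
  have hj := hjk.trans hk
  have hi := hij.trans hj
  exact hGP.cr_ne_zero (hmem i hi) (hmem j hj) (hmem k hk) (fun h => hij.ne (hinj hi hj h))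
    (fun h => (hij.trans hjk).ne (hinj hi hk h)) (fun h => hjk.ne (hinj hj hk h))

theorem needs_of_check {n N M k : ℕ} {φ : SignFormula} (hn : 0 < n) (hN : PairNumbering n N)
    (hM : TripleNumbering n M) (hcheck : ∀ v < 2 ^ M, check n N k φ v = true) {R : Finset Plane}
    (hR : R.card = n)
    (hφ : ∀ (p : ℕ → Plane) (e : ℕ → ℕ → ℕ → Bool), (Finset.range n).image p = R →
      Represents e p n → φ.eval e = false) : Needs R (k + 1) := by
  intro B hRB hGP hits
  obtain ⟨p, v, hv, rfl, hinj, h0, hbit, hne⟩ :=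
    exists_assignment (hGP.mono Set.subset_union_left) hn hR hM
  have hrep := redSign_represents hne h0 hbit
  refine lt_card_of_check (hcheck v hv) hN hrep h0 (hφ p _ rfl hrep) ?_ hits
  intro x hx i j hij hj
  have hi := hij.trans hj
  have hmem : ∀ i < n, p i ∈ (Finset.range n).image p := fun i hi =>
    Finset.mem_image_of_mem p (Finset.mem_range.2 hi)
  have hxne : ∀ i < n, p i ≠ x := fun i hi h =>
    Finset.disjoint_left.1 hRB (hmem i hi) (h ▸ hx)
  exact hGP.cr_ne_zero (Or.inl (hmem i hi)) (Or.inl (hmem j hj)) (Or.inr hx)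
    (fun h => hij.ne (hinj hi hj h)) (hxne i hi) (hxne j hj)

/-- The formula for `HasInnerPoint`. -/
def innerPoint (n : ℕ) : SignFormula :=
  disj ((List.range n).map fun a => disj ((List.range n).map fun b => disj ((List.range n).map
    fun c => and (left a b c) (and
      (disj ((List.range n).map fun d => and (left b c d) (and (left c d a) (left d a b))))
      (disj ((List.range n).map fun x => and (left a b x) (and (left b c x) (left c a x))))))))

theorem hasInnerPoint_of_eval {e : ℕ → ℕ → ℕ → Bool} {p : ℕ → Plane} {n : ℕ}
    (h : Represents e p n) (he : (innerPoint n).eval e = true) :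
    HasInnerPoint ((Finset.range n).image p) := by
  simp only [innerPoint, eval_disj, List.mem_map, List.mem_range, exists_exists_and_eq_and,
    eval_and, Bool.and_eq_true] at he
  obtain ⟨a, ha, b, hb, c, hc, h1, ⟨d, hd, h2, h3, h4⟩, x, hx, h5, h6, h7⟩ := he
  simp only [h.eval_left, ha, hb, hc, hd, hx, decide_eq_true_eq] at h1 h2 h3 h4 h5 h6 h7
  have hmem : ∀ i < n, p i ∈ (Finset.range n).image p := fun i hi =>
    Finset.mem_image_of_mem p (Finset.mem_range.2 hi)
  exact ⟨_, hmem a ha, _, hmem b hb, _, hmem c hc, _, hmem d hd, _, hmem x hx, ⟨h1, h2, h3, h4⟩,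
    h5, h6, h7⟩

set_option maxRecDepth 100000

/-- The arguments of `check` are the number of points, the number of pairs, the number of blockers
shown to be insufficient, and the exceptional case, with `falsum` for none. -/
theorem allLt_check_four : allLt 2 (check 4 6 1 falsum) = true := by decide +kernel

theorem allLt_check_five : allLt 16 (check 5 10 3 (innerPoint 5)) = true := by decide +kernel

/-- `check` for six points and the assignments number `128 * c` to `128 * c + 127`. -/
noncomputable def checkSix (c : ℕ) : Bool :=
  allLt 128 fun v => force (Nat.add (Nat.mul 128 c) v) (check 6 15 4 falsum)

theorem checkSix_zero : checkSix 0 = true := by decide +kernel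
theorem checkSix_one : checkSix 1 = true := by decide +kernel
theorem checkSix_two : checkSix 2 = true := by decide +kernel
theorem checkSix_three : checkSix 3 = true := by decide +kernel
theorem checkSix_four : checkSix 4 = true := by decide +kernel
theorem checkSix_five : checkSix 5 = true := by decide +kernel
theorem checkSix_six : checkSix 6 = true := by decide +kernel
theorem checkSix_seven : checkSix 7 = true := by decide +kernel

theorem check_six {v : ℕ} (hv : v < 2 ^ 10) : check 6 15 4 falsum v = true := by
  have key : ∀ c < 8, checkSix c = true := by
    intro c hc
    interval_cases c
    exacts [checkSix_zero, checkSix_one, checkSix_two, checkSix_three, checkSix_four,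
      checkSix_five, checkSix_six, checkSix_seven]
  have h := of_allLt (key (v / 128) (by omega)) (Nat.mod_lt v (by norm_num : 0 < 128))
  rw [force_eq] at h
  rwa [← Nat.div_add_mod v 128]

theorem needs_two {R : Finset Plane} (hR : R.card = 4) : Needs R 2 :=
  needs_of_check (by norm_num) pairNumbering_four tripleNumbering_four
    (fun _ hv => of_allLt allLt_check_four hv) hR fun _ _ _ _ => rfl

theorem needs_four {R : Finset Plane} (hR : R.card = 5) (h : ¬ HasInnerPoint R) : Needs R 4 := by
  refine needs_of_check (by norm_num) pairNumbering_five tripleNumbering_five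
    (fun _ hv => of_allLt allLt_check_five hv) hR fun p e hp hrep => ?_
  rw [Bool.eq_false_iff]
  rintro he
  exact h (hp ▸ hasInnerPoint_of_eval hrep he)

theorem needs_five {R : Finset Plane} (hR : R.card = 6) : Needs R 5 :=
  needs_of_check (by norm_num) pairNumbering_six tripleNumbering_six
    (fun _ hv => check_six hv) hR fun _ _ _ _ => rfl

/-! ### Induction steps: deleting a point and splitting along a line -/

theorem InTriangle.mem_of_convex {H : Set Plane} (hH : Convex ℝ H) {a b c x : Plane}
    (h : InTriangle a b c x) (ha : a ∈ H) (hb : b ∈ H) (hc : c ∈ H) : x ∈ H := by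
  rcases h with ⟨h1, h2, h3⟩ | ⟨h1, h2, h3⟩
  · refine convexHull_min ?_ hH (mem_convexHull_of_cr_pos h1 h2 h3)
    simp [Set.insert_subset_iff, ha, hb, hc]
  · refine convexHull_min ?_ hH (mem_convexHull_of_cr_pos h1 h3 h2)
    simp [Set.insert_subset_iff, ha, hb, hc]

/-- One half of a bowtie lies in the triangle on three of the vertices; `key` is the
Grassmann–Plücker relation that yields the missing side condition. -/
theorem inTriangle_of_convexQuad {a b c d x : Plane} (h : ConvexQuad a b c d) (h1 : 0 < cr a b x)
    (h2 : 0 < cr c a x) (h3 : 0 < cr b d x) : InTriangle a b c x := by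
  obtain ⟨q1, q2, q3, q4⟩ := h
  have key : cr d a b * cr b c x = cr b c d * cr a b x + cr a b c * cr b d x := by
    simp only [cr]; ring
  have : 0 < cr d a b * cr b c x := by rw [key]; positivity
  exact Or.inl ⟨h1, pos_of_mul_pos_right this q4.le, h2⟩

theorem InBowtie.mem_of_convex {H : Set Plane} (hH : Convex ℝ H) {a b c d x : Plane}
    (hq : ConvexQuad a b c d) (h : InBowtie a b c d x) (ha : a ∈ H) (hb : b ∈ H) (hc : c ∈ H)
    (hd : d ∈ H) : x ∈ H := by
  rcases h with ⟨h1, h2, h3⟩ | ⟨h1, h2, h3⟩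
  · exact (inTriangle_of_convexQuad hq h1 h2 h3).mem_of_convex hH ha hb hc
  · exact (inTriangle_of_convexQuad ⟨hq.2.2.1, hq.2.2.2, hq.1, hq.2.1⟩ h1 h2 h3).mem_of_convex hH
      hc hd ha

/-- Structures on the points in a convex set are hit by points in this convex set. -/
theorem HitsAll.restrict {B R B' R' : Finset Plane} (h : HitsAll B R) {H : Set Plane}
    (hH : Convex ℝ H) (hR' : R' ⊆ R) (hR'H : ∀ r ∈ R', r ∈ H) (hR : ∀ r ∈ R, r ∈ H → r ∈ R')
    (hB : ∀ x ∈ B, x ∈ H → x ∈ B') : HitsAll B' R' := by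
  constructor
  · intro a ha b hb c hc d hd hq hr
    have hmem : ∀ x, InBowtie a b c d x → x ∈ H := fun x hx =>
      hx.mem_of_convex hH hq (hR'H a ha) (hR'H b hb) (hR'H c hc) (hR'H d hd)
    obtain ⟨x, hx, hi⟩ := h.1 a (hR' ha) b (hR' hb) c (hR' hc) d (hR' hd) hq
      fun r hrR hi => hr r (hR r hrR (hmem r hi)) hi
    exact ⟨x, hB x hx (hmem x hi), hi⟩
  · intro d hd a ha b hb c hc ht hr
    have hmem : ∀ x, InTriangle d a b x ∨ InTriangle d a c x → x ∈ H := by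
      rintro x (hx | hx)
      · exact hx.mem_of_convex hH (hR'H d hd) (hR'H a ha) (hR'H b hb)
      · exact hx.mem_of_convex hH (hR'H d hd) (hR'H a ha) (hR'H c hc)
    obtain ⟨x, hx, hi⟩ := h.2 d (hR' hd) a (hR' ha) b (hR' hb) c (hR' hc) ht
      fun r hrR hi => hr r (hR r hrR (hmem r hi)) hi
    exact ⟨x, hB x hx (hmem x hi), hi⟩

/-- Removing a point `r` that sees at least two edges `ab`, `bc` of the convex hull of the other
points saves a blocker. -/
theorem Needs.of_erase {R : Finset Plane} {k : ℕ} {r a b c : Plane} (hk : Needs (R.erase r) k)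
    (hr : r ∈ R) (ha : a ∈ R.erase r) (hb : b ∈ R.erase r) (hc : c ∈ R.erase r)
    (hab : ∀ x ∈ R.erase r, x = a ∨ x = b ∨ 0 < cr a b x)
    (hbc : ∀ x ∈ R.erase r, x = b ∨ x = c ∨ 0 < cr b c x)
    (har : 0 < cr b a r) (hcr : 0 < cr c b r) (hac : a ≠ c) : Needs R (k + 1) := by
  intro B hRB hGP hits
  have hc0 : 0 < cr a b c := by
    rcases hab c hc with h | h | h
    · exact absurd h.symm hac
    · subst h; simp [cr_self_left] at hcr
    · exact h
  have hH1 : ∀ x ∈ R.erase r, 0 ≤ cr a b x := by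
    intro x hx
    rcases hab x hx with rfl | rfl | h
    · rw [cr_self_outer]
    · rw [cr_self_right]
    · exact h.le
  have hH2 : ∀ x ∈ R.erase r, 0 ≤ cr b c x := by
    intro x hx
    rcases hbc x hx with rfl | rfl | h
    · rw [cr_self_outer]
    · rw [cr_self_right]
    · exact h.le
  have hin1 : ∀ y, InTriangle b r a y → 0 < cr b a y := by
    rintro y (⟨h1, h2, h3⟩ | ⟨h1, h2, h3⟩)
    · exfalso; simp only [cr] at *; linarith
    · exact h3
  have hin2 : ∀ y, InTriangle b r c y → 0 < cr c b y := by
    rintro y (⟨h1, h2, h3⟩ | ⟨h1, h2, h3⟩)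
    · exact h3
    · exfalso; simp only [cr] at *; linarith
  have hmem := fun {x} (hx : x ∈ R.erase r) => Finset.mem_of_mem_erase hx
  have hnot : ∀ y, 0 ≤ cr a b y → 0 ≤ cr b c y → ¬ (InTriangle b r a y ∨ InTriangle b r c y) := by
    rintro y h1 h2 (h | h)
    · have := hin1 y h
      rw [cr_swap] at this; linarith
    · have := hin2 y h
      rw [cr_swap] at this; linarith
  -- Since `r` sees both edges, `b` lies inside the triangle `r a c`. The pant made of `b r a` and
  -- `b r c` lies beyond these edges, so its blocker `y` is of no use to the remaining points.
  obtain ⟨y, hy, hyi⟩ := hits.2 b (hmem hb) r hr a (hmem ha) c (hmem hc)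
    (Or.inr ⟨by simp only [cr] at *; linarith, by simp only [cr] at *; linarith,
      by simp only [cr] at *; linarith⟩) (by
      intro x hx
      by_cases hxr : x = r
      · subst hxr
        rintro ((⟨h1, -, -⟩ | ⟨h1, -, -⟩) | (⟨h1, -, -⟩ | ⟨h1, -, -⟩)) <;>
          simp [cr_self_right, cr_self_outer] at h1
      · exact hnot x (hH1 x (Finset.mem_erase.2 ⟨hxr, hx⟩)) (hH2 x (Finset.mem_erase.2 ⟨hxr, hx⟩)))
  have hrest : HitsAll (B.erase y) (R.erase r) := by
    refine hits.restrict ((convex_halfPlane a b).inter (convex_halfPlane b c))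
      (Finset.erase_subset _ _) (fun x hx => ⟨hH1 x hx, hH2 x hx⟩) ?_ ?_
    · rintro x hx ⟨h1, -⟩
      refine Finset.mem_erase.2 ⟨?_, hx⟩
      rintro rfl
      have h1 : 0 ≤ cr a b x := h1
      rw [cr_swap] at har; linarith
    · rintro x hx ⟨h1, h2⟩
      refine Finset.mem_erase.2 ⟨?_, hx⟩
      rintro rfl
      exact hnot x h1 h2 hyi
  have := hk (B.erase y) (hRB.mono (Finset.erase_subset _ _) (Finset.erase_subset _ _))
    (hGP.mono (Set.union_subset_union (by simp)
      (by simp))) hrest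
  rw [Finset.card_erase_of_mem hy] at this
  have := Finset.card_pos.2 ⟨y, hy⟩
  omega

/-- The blockers on the two sides of a line through two points. -/
theorem Needs.of_split {R R₁ R₂ : Finset Plane} {k₁ k₂ : ℕ} {a b : Plane} (h₁ : Needs R₁ k₁)
    (h₂ : Needs R₂ k₂) (ha : a ∈ R) (hb : b ∈ R) (hab : a ≠ b) (hR₁ : R₁ ⊆ R) (hR₂ : R₂ ⊆ R)
    (hin₁ : ∀ r ∈ R₁, 0 ≤ cr a b r) (hin₂ : ∀ r ∈ R₂, 0 ≤ cr b a r)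
    (hout₁ : ∀ r ∈ R, 0 ≤ cr a b r → r ∈ R₁) (hout₂ : ∀ r ∈ R, 0 ≤ cr b a r → r ∈ R₂) :
    Needs R (k₁ + k₂) := by
  classical
  intro B hRB hGP hits
  -- Structures on the red points of a closed half-plane stay in that half-plane, so only the
  -- blockers there count.
  have key : ∀ R' ⊆ R, ∀ p q : Plane, ∀ k, Needs R' k → (∀ r ∈ R', 0 ≤ cr p q r) →
      (∀ r ∈ R, 0 ≤ cr p q r → r ∈ R') → k ≤ (B.filter fun x => 0 ≤ cr p q x).card := by
    intro R' hR' p q k hk hin hout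
    refine hk _ (hRB.mono hR' (Finset.filter_subset _ _)) (hGP.mono (Set.union_subset_union
      (Finset.coe_subset.2 hR') (Finset.coe_subset.2 (Finset.filter_subset _ _)))) ?_
    exact hits.restrict (convex_halfPlane p q) hR' hin hout
      fun x hx h => Finset.mem_filter.2 ⟨hx, h⟩
  have e1 := key R₁ hR₁ a b k₁ h₁ hin₁ hout₁
  have e2 := key R₂ hR₂ b a k₂ h₂ hin₂ hout₂
  -- General position keeps blockers off the line `ab`, so none is counted twice, although `a` and
  -- `b` belong to both sides.
  have hdisj : Disjoint (B.filter fun x => 0 ≤ cr a b x) (B.filter fun x => 0 ≤ cr b a x) := by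
    rw [Finset.disjoint_left]
    intro x hx hx'
    obtain ⟨hxB, h1⟩ := Finset.mem_filter.1 hx
    obtain ⟨-, h2⟩ := Finset.mem_filter.1 hx'
    rw [cr_swap] at h2
    exact hGP.cr_ne_zero (Or.inl ha) (Or.inl hb) (Or.inr hxB) hab
      (fun h => Finset.disjoint_left.1 hRB ha (h ▸ hxB))
      (fun h => Finset.disjoint_left.1 hRB hb (h ▸ hxB)) (by linarith)
  calc k₁ + k₂ ≤ _ := Nat.add_le_add e1 e2
    _ = _ := (Finset.card_union_of_disjoint hdisj).symm
    _ ≤ B.card := Finset.card_le_card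
      (Finset.union_subset (Finset.filter_subset _ _) (Finset.filter_subset _ _))

/-! ### Convex pentagons -/

/-- The orientations of the vertices of a convex pentagon. -/
def cyclicSign (i j k : Fin 5) : Bool :=
  (i < j && j < k) || (j < k && k < i) || (k < i && i < j)

/-- This excludes an inner point for points in convex position by enumeration of all index choices.
-/
theorem cyclicSign_pentagon (a b c d x : Fin 5) : ¬ (cyclicSign a b c ∧ cyclicSign b c d ∧
    cyclicSign c d a ∧ cyclicSign d a b ∧ cyclicSign a b x ∧ cyclicSign b c x ∧
    cyclicSign c a x) := by
  revert a b c d x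
  decide +kernel

theorem cyclicSign_of_cr_pos {t : Fin 5 → Plane}
    (ht : ∀ i j k, i < j → j < k → 0 < cr (t i) (t j) (t k)) {i j k : Fin 5}
    (h : 0 < cr (t i) (t j) (t k)) : cyclicSign i j k = true := by
  obtain ⟨h1, h2, h3⟩ := ne_of_cr_pos h
  have h1 : i ≠ j := fun h => h1 (h ▸ rfl)
  have h2 : i ≠ k := fun h => h2 (h ▸ rfl)
  have h3 : j ≠ k := fun h => h3 (h ▸ rfl)
  by_contra hc
  have hodd : (i < k ∧ k < j) ∨ (k < j ∧ j < i) ∨ (j < i ∧ i < k) := by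
    simp only [cyclicSign, Bool.or_eq_true, Bool.and_eq_true, decide_eq_true_eq] at hc
    omega
  rcases hodd with ⟨h4, h5⟩ | ⟨h4, h5⟩ | ⟨h4, h5⟩
  · have := ht i k j h4 h5
    rw [cr_swap_right] at this; linarith
  · have := ht k j i h4 h5
    rw [← cr_rotate, ← cr_rotate, cr_swap_right, cr_rotate] at h
    simp only [cr] at *; linarith
  · have := ht j i k h4 h5
    rw [cr_swap] at this; linarith

theorem not_hasInnerPoint {t : Fin 5 → Plane}
    (ht : ∀ i j k, i < j → j < k → 0 < cr (t i) (t j) (t k)) :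
    ¬ HasInnerPoint (Finset.univ.image t) := by
  rintro ⟨a, ha, b, hb, c, hc, d, hd, x, hx, ⟨h1, h2, h3, h4⟩, h5, h6, h7⟩
  simp only [Finset.mem_image, Finset.mem_univ, true_and] at ha hb hc hd hx
  obtain ⟨a, rfl⟩ := ha
  obtain ⟨b, rfl⟩ := hb
  obtain ⟨c, rfl⟩ := hc
  obtain ⟨d, rfl⟩ := hd
  obtain ⟨x, rfl⟩ := hx
  have key := fun {i j k} => cyclicSign_of_cr_pos ht (i := i) (j := j) (k := k)
  exact cyclicSign_pentagon a b c d x ⟨key h1, key h2, key h3, key h4, key h5, key h6, key h7⟩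

/-! ### Seven points -/

namespace SignFormula

/-- The line segments `ab` and `bc` are edges of the convex hull of the points below `n` other than
`r`, and `r` sees both edges. -/
def sees (n r a b c : ℕ) : SignFormula :=
  and (left b a r) (and (left c b r) (conj ((List.range n).map fun x =>
    bif Nat.beq x r then verum else
      and (bif Nat.beq x a || Nat.beq x b then verum else left a b x)
        (bif Nat.beq x b || Nat.beq x c then verum else left b c x))))

/-- The points `i`, `j`, `a`, `b`, `c` are the vertices of a convex pentagon in this order, and the
points `u` and `v` lie beyond its edge `ij`. -/
def pentagonAndPair (i j a b c u v : ℕ) : SignFormula :=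
  conj [left i j a, left i j b, left i j c, left i a b, left i a c, left i b c, left j a b,
    left j a c, left j b c, left a b c, left j i u, left j i v]

end SignFormula

theorem Represents.needs_of_sees {e : ℕ → ℕ → ℕ → Bool} {p : ℕ → Plane} {n k : ℕ}
    (h : Represents e p n) (hinj : Set.InjOn p (Set.Iio n)) {r a b c : ℕ} (hr : r < n)
    (ha : a < n ∧ a ≠ r) (hb : b < n ∧ b ≠ r) (hc : c < n ∧ c ≠ r) (hac : a ≠ c)
    (he : (sees n r a b c).eval e = true)
    (hk : Needs (((Finset.range n).image p).erase (p r)) k) :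
    Needs ((Finset.range n).image p) (k + 1) := by
  have hbeq : ∀ x y, Nat.beq x y = decide (x = y) := fun x y => by
    rw [Bool.eq_iff_iff, Nat.beq_eq, decide_eq_true_iff]
  simp only [sees, eval_and, Bool.and_eq_true, eval_conj, List.forall_mem_map, List.mem_range,
    h.eval_left hb.1 ha.1 hr, h.eval_left hc.1 hb.1 hr, decide_eq_true_eq, hbeq] at he
  obtain ⟨har, hcr, hall⟩ := he
  have hmem : ∀ i < n, p i ∈ (Finset.range n).image p := fun i hi =>
    Finset.mem_image_of_mem p (Finset.mem_range.2 hi)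
  have herase : ∀ i, i < n ∧ i ≠ r → p i ∈ ((Finset.range n).image p).erase (p r) := fun i hi =>
    Finset.mem_erase.2 ⟨fun h => hi.2 (hinj hi.1 hr h), hmem i hi.1⟩
  have hother : ∀ y ∈ ((Finset.range n).image p).erase (p r),
      (y = p a ∨ y = p b ∨ 0 < cr (p a) (p b) y) ∧ (y = p b ∨ y = p c ∨ 0 < cr (p b) (p c) y) := by
    intro y hy
    obtain ⟨hyr, hy⟩ := Finset.mem_erase.1 hy
    obtain ⟨x, hx, rfl⟩ := Finset.mem_image.1 hy
    have hx := Finset.mem_range.1 hx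
    have hxr : x ≠ r := fun h => hyr (h ▸ rfl)
    have := hall x hx
    simp only [hxr, decide_false, cond_false, eval_and, Bool.and_eq_true] at this
    constructor
    · by_cases h1 : x = a
      · exact Or.inl (h1 ▸ rfl)
      by_cases h2 : x = b
      · exact Or.inr (Or.inl (h2 ▸ rfl))
      have h3 := this.1
      simp only [h1, h2, decide_false, Bool.or_self, cond_false, h.eval_left ha.1 hb.1 hx,
        decide_eq_true_eq] at h3
      exact Or.inr (Or.inr h3)
    · by_cases h1 : x = b
      · exact Or.inl (h1 ▸ rfl)
      by_cases h2 : x = c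
      · exact Or.inr (Or.inl (h2 ▸ rfl))
      have h3 := this.2
      simp only [h1, h2, decide_false, Bool.or_self, cond_false, h.eval_left hb.1 hc.1 hx,
        decide_eq_true_eq] at h3
      exact Or.inr (Or.inr h3)
  exact hk.of_erase (hmem r hr) (herase a ha) (herase b hb) (herase c hc)
    (fun y hy => (hother y hy).1) (fun y hy => (hother y hy).2) har hcr
    fun h => hac (hinj ha.1 hc.1 h)

/-- The line `ij` puts the pentagon, needing 4 blockers, on one side, and the four points `i`, `j`,
`u`, `v`, needing 2, on the other. -/
theorem Represents.needs_of_pentagonAndPair {e : ℕ → ℕ → ℕ → Bool} {p : ℕ → Plane} {n : ℕ}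
    (h : Represents e p n) (hinj : Set.InjOn p (Set.Iio n)) {i j a b c u v : ℕ}
    (hrange : {i, j, a, b, c, u, v} = Finset.range n)
    (h₁ : ({i, j, a, b, c} : Finset ℕ).card = 5) (h₂ : ({i, j, u, v} : Finset ℕ).card = 4)
    (he : (pentagonAndPair i j a b c u v).eval e = true) :
    Needs ((Finset.range n).image p) 6 := by
  have hlt : ∀ x ∈ ({i, j, a, b, c, u, v} : Finset ℕ), x < n := fun x hx =>
    Finset.mem_range.1 (hrange ▸ hx)
  have hi : i < n := hlt i (by simp)
  have hj : j < n := hlt j (by simp)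
  have ha : a < n := hlt a (by simp)
  have hb : b < n := hlt b (by simp)
  have hc : c < n := hlt c (by simp)
  have hu : u < n := hlt u (by simp)
  have hv : v < n := hlt v (by simp)
  simp only [pentagonAndPair, eval_conj_cons, eval_conj_nil, Bool.and_true, Bool.and_eq_true,
    h.eval_left, hi, hj, ha, hb, hc, hu, hv, decide_eq_true_eq] at he
  obtain ⟨ija, ijb, ijc, iab, iac, ibc, jab, jac, jbc, abc, jiu, jiv⟩ := he
  have hsub₁ : ({i, j, a, b, c} : Finset ℕ) ⊆ Finset.range n := by
    rw [← hrange]; intro x; simp only [Finset.mem_insert, Finset.mem_singleton]; tauto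
  have hsub₂ : ({i, j, u, v} : Finset ℕ) ⊆ Finset.range n := by
    rw [← hrange]; intro x; simp only [Finset.mem_insert, Finset.mem_singleton]; tauto
  have hinj' : ∀ s ⊆ Finset.range n, (s.image p).card = s.card := fun s hs =>
    Finset.card_image_of_injOn (hinj.mono fun x hx => Finset.mem_range.1 (hs hx))
  have himage : ({i, j, a, b, c} : Finset ℕ).image p =
      Finset.univ.image ![p i, p j, p a, p b, p c] := by
    ext y
    simp [Fin.exists_fin_succ, eq_comm]
  have hpent : ¬ HasInnerPoint (({i, j, a, b, c} : Finset ℕ).image p) := by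
    rw [himage]
    apply not_hasInnerPoint
    intro x y z hxy hyz
    fin_cases x <;> fin_cases y <;> fin_cases z <;>
      first | assumption | exact absurd hxy (by decide) | exact absurd hyz (by decide)
  have hn₁ := needs_four ((hinj' _ hsub₁).trans h₁) hpent
  have hn₂ := needs_two ((hinj' _ hsub₂).trans h₂)
  have hmem : ∀ i < n, p i ∈ (Finset.range n).image p := fun i hi =>
    Finset.mem_image_of_mem p (Finset.mem_range.2 hi)
  have hneg : ∀ {x y z : Plane}, 0 < cr x y z → ¬ 0 ≤ cr y x z := fun {x y z} h => by
    rw [cr_swap]; linarith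
  refine Needs.of_split hn₁ hn₂ (hmem i hi) (hmem j hj) (ne_of_cr_pos ija).1
    (Finset.image_subset_image hsub₁) (Finset.image_subset_image hsub₂) ?_ ?_ ?_ ?_
  · simp [cr_self_right, cr_self_outer, ija.le, ijb.le, ijc.le]
  · simp [cr_self_right, cr_self_outer, jiu.le, jiv.le]
  · rw [← hrange]
    simp [hneg jiu, hneg jiv]
  · rw [← hrange]
    simp [hneg ija, hneg ijb, hneg ijc]

/-- The truth tables for the orientations of `N` triples of points other than `0` and of the triples
that contain `0`, which are positively oriented. -/
noncomputable def redTable (N full i j k : ℕ) : ℕ :=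
  bif Nat.beq i 0 then full
  else column (tripleRank i j k) (Nat.sub (Nat.sub N 1) (tripleRank i j k))

theorem redTable_represents {n N v : ℕ} (hN : TripleNumbering n N) {p : ℕ → Plane} (hv : v < 2 ^ N)
    (hne : ∀ i j k, i < j → j < k → k < n → cr (p i) (p j) (p k) ≠ 0)
    (h0 : ∀ j k, 0 < j → j < k → k < n → 0 < cr (p 0) (p j) (p k))
    (hbit : ∀ i j k, 0 < i → i < j → j < k → k < n →
      v.testBit (tripleRank i j k) = decide (0 < cr (p i) (p j) (p k))) :
    Represents (fun i j k => (redTable N (ones (Nat.pow 2 N)) i j k).testBit v) p n := by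
  intro i j k hij hjk hk
  refine ⟨hne i j k hij hjk hk, ?_⟩
  rcases Nat.eq_zero_or_pos i with rfl | hi
  · have hfull : (ones (Nat.pow 2 N)).testBit v = true := by
      rw [testBit_ones]; exact decide_eq_true hv
    simpa [redTable, h0 j k hij hjk hk] using hfull
  · have hlt : tripleRank i j k < N := (hN _ (mem_tripleList hi hij hjk hk)).1
    simp only [redTable, beq_zero_of_ne hi.ne', cond_false]
    rw [← hbit i j k hi hij hjk hk]
    apply testBit_column
    change v < 2 ^ (tripleRank i j k + (N - 1 - tripleRank i j k + 1))
    rwa [show tripleRank i j k + (N - 1 - tripleRank i j k + 1) = N by omega]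

/-- The points 1 and 6 are the hull neighbours of 0. Without 6, the segment from 5 to 0 is a hull
edge seen by 6, so `sees` only asks for the edge before it; symmetrically for 1 and the edge after
the one from 0 to 2. The configurations not covered in this way are split by a line. -/
def sevenPointCases : SignFormula :=
  disj [sees 7 6 4 5 0, sees 7 1 0 2 3, sees 7 6 2 5 0, sees 7 1 0 2 5, sees 7 1 0 2 6,
    sees 7 6 1 5 0, pentagonAndPair 0 3 4 5 6 1 2, pentagonAndPair 4 0 1 2 3 5 6,
    pentagonAndPair 3 4 6 0 1 2 5, pentagonAndPair 3 2 5 6 4 0 1, pentagonAndPair 4 3 1 2 5 0 6]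

/-- The list is exhaustive: the implication from the axioms has all 2^20 bits set. -/
theorem table_sevenPointCases :
    Nat.beq ((or (neg (redAxioms 7)) sevenPointCases).table (ones (Nat.pow 2 20))
      (redTable 20 (ones (Nat.pow 2 20)))) (ones (Nat.pow 2 20)) = true := by
  decide +kernel

theorem needs_six {R : Finset Plane} (hGP : GeneralPosition (R : Set Plane)) (hR : R.card = 7) :
    Needs R 6 := by
  obtain ⟨p, v, hv, rfl, hinj, h0, hbit, hne⟩ :=
    exists_assignment hGP (by norm_num) hR tripleNumbering_seven
  have hrep := redTable_represents tripleNumbering_seven hv hne h0 hbit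
  have hfull : (ones (Nat.pow 2 20)).testBit v = true := by
    rw [testBit_ones]; exact decide_eq_true hv
  have hcases := testBit_table hfull (redTable 20 (ones (Nat.pow 2 20)))
    (or (neg (redAxioms 7)) sevenPointCases)
  rw [Nat.eq_of_beq_eq_true table_sevenPointCases, hfull, eval_or, eval_neg,
    hrep.eval_redAxioms h0, Bool.not_true, Bool.false_or] at hcases
  have herase : ∀ r < 7, Needs (((Finset.range 7).image p).erase (p r)) 5 := fun r hr => by
    apply needs_five
    rw [Finset.card_erase_of_mem (Finset.mem_image_of_mem p (Finset.mem_range.2 hr)), hR]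
  have hsees : ∀ r a b c, r < 7 → (a < 7 ∧ a ≠ r) → (b < 7 ∧ b ≠ r) → (c < 7 ∧ c ≠ r) → a ≠ c →
      (sees 7 r a b c).eval _ = true → Needs ((Finset.range 7).image p) 6 :=
    fun r a b c hr ha hb hc hac he =>
      hrep.needs_of_sees hinj hr ha hb hc hac he (herase r hr)
  have hpent : ∀ i j a b c u w, {i, j, a, b, c, u, w} = Finset.range 7 →
      ({i, j, a, b, c} : Finset ℕ).card = 5 → ({i, j, u, w} : Finset ℕ).card = 4 →
      (pentagonAndPair i j a b c u w).eval _ = true → Needs ((Finset.range 7).image p) 6 :=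
    fun i j a b c u w h h₁ h₂ he => hrep.needs_of_pentagonAndPair hinj h h₁ h₂ he
  obtain ⟨φ, hφ, he⟩ := (eval_disj _ _).1 hcases.symm
  simp only [List.mem_cons, List.not_mem_nil, or_false] at hφ
  rcases hφ with rfl | rfl | rfl | rfl | rfl | rfl | rfl | rfl | rfl | rfl | rfl
  iterate 6
    exact hsees _ _ _ _ (by decide) (by decide) (by decide) (by decide) (by decide) he
  all_goals exact hpent _ _ _ _ _ _ _ (by decide) (by decide) (by decide) he

theorem mainTheorem7 :
    Requires {pant, bowtie} 6 5 ∧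
    Requires {pant, bowtie} 7 6 ∧
    (∀ R : Finset Plane, GeneralPosition (R : Set Plane) → R.card = 5 →
      hullSize R = 3 ∨ hullSize R = 5 → RequiresBlockers {pant, bowtie} R 4) := by
  refine ⟨fun R _ hR => (needs_five hR).requiresBlockers,
    fun R hGP hR => (needs_six hGP hR).requiresBlockers, fun R _ hR hhull => ?_⟩
  -- An inner point would force hull size 4.
  refine (needs_four hR fun h => ?_).requiresBlockers
  have := hullSize_eq_four hR h
  omega
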